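/- \textsc{Biclique-Free Vertex Deletion} (BFVD) is the following decision problem: given a finite simple undirected graph $G$ and integers $i, j, k \ge 1$ with $i \le j$, decide whether there is a set $V' \subseteq V(G)$ with $|V'| \le k$ such that $G - V'$ contains no complete bipartite graph $K_{i,j}$ as a (not necessarily induced) subgraph. The numbers $i, j, k$ are part of the input. Let $\mathrm{fvn}(G)$ be the feedback vertex number of $G$, that is, the minimum size of a set $D \subseteq V(G)$ such that $G - D$ is a forest. \textbf{Theorem.} Restricted to instances with $i \ge 2$, BFVD can be solved in $2^{O(k^2 + \mathrm{fvn}(G)\cdot k)} \cdot n^{O(1)}$ time, where $n = |V(G)|$. That is, there are a single deterministic algorithm (on a unit-cost random access machine whose arithmetic operations are addition and truncated subtraction, with $G$ given by its adjacency matrix and no feedback vertex set given) and a constant $c$ such that for every graph $G$ on $n \ge 0$ vertices and all integers $2 \le i \le j$ and $k \ge 1$, the algorithm correctly decides the instance $(G, i, j, k)$ within $2^{c\,(k^2 + \mathrm{fvn}(G)\cdot k)} \cdot (n+1)^{c}$ steps. -/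

import Mathlib

/-! # Biclique-free vertex deletion and a random access machine with step count -/

namespace BFVD

/-! ## The problem -/

/-- The instance `(G, i, j, k)` is a yes-instance: one can delete at most `k` vertices so that the
remaining graph has no (not necessarily induced) subgraph isomorphic to `K_{i,j}`. -/
def IsYes {V : Type*} (G : SimpleGraph V) (i j k : ℕ) : Prop :=
  ∃ X : Finset V, X.card ≤ k ∧
    (completeBipartiteGraph (Fin i) (Fin j)).Free (G.induce ((X : Set V)ᶜ))

/-- `D` is a feedback vertex set of `G`: deleting `D` leaves a forest. -/
def IsFeedbackVertexSet {V : Type*} (G : SimpleGraph V) (D : Finset V) : Prop :=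
  (G.induce ((D : Set V)ᶜ)).IsAcyclic

/-- The feedback vertex number of a finite graph: the least size of a feedback vertex set.
(The set of sizes is nonempty, as the set of all vertices is a feedback vertex set.) -/
noncomputable def fvn {V : Type*} [Fintype V] (G : SimpleGraph V) : ℕ :=
  sInf {d | ∃ D : Finset V, IsFeedbackVertexSet G D ∧ D.card = d}

/-! ## The machine model

A random access machine with unit cost and structured control. A program uses finitely many
registers and finitely many arrays, all of which hold natural numbers; arrays are addressed
indirectly. The arithmetic operations are addition and truncated subtraction only: there is no
multiplication, so that the unit-cost measure is polynomially related to Turing machine time. -/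

/-- A machine state: the contents of the registers and of the arrays. -/
@[ext] structure State where
  /-- `reg x` is the content of register `x`. -/
  reg : ℕ → ℕ
  /-- `arr a m` is the content of cell `m` of array `a`. -/
  arr : ℕ → ℕ → ℕ

/-- Store `v` in register `x`. -/
def State.setReg (s : State) (x v : ℕ) : State :=
  { s with reg := Function.update s.reg x v }

/-- Store `v` in cell `m` of array `a`. -/
def State.setArr (s : State) (a m v : ℕ) : State :=
  { s with arr := Function.update s.arr a (Function.update (s.arr a) m v) }

/-- Expressions. -/
inductive Expr where
  /-- a constant -/
  | const (c : ℕ)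
  /-- the content of register `x` -/
  | reg (x : ℕ)
  /-- the content of the cell of array `a` whose address is the value of `e` -/
  | read (a : ℕ) (e : Expr)
  /-- addition -/
  | add (e f : Expr)
  /-- truncated subtraction -/
  | sub (e f : Expr)

/-- The value of an expression in a state. -/
def Expr.eval (s : State) : Expr → ℕ
  | .const c => c
  | .reg x => s.reg x
  | .read a e => s.arr a (e.eval s)
  | .add e f => e.eval s + f.eval s
  | .sub e f => e.eval s - f.eval s

/-- The number of elementary steps taken to evaluate an expression: one for each constant, each
register access, each array access and each arithmetic operation in it. -/
def Expr.cost : Expr → ℕ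
  | .const _ => 1
  | .reg _ => 1
  | .read _ e => e.cost + 1
  | .add e f => e.cost + f.cost + 1
  | .sub e f => e.cost + f.cost + 1

/-- Programs. -/
inductive Prog where
  /-- do nothing -/
  | skip
  /-- store the value of `e` in register `x` -/
  | assign (x : ℕ) (e : Expr)
  /-- store the value of `f` in the cell of array `a` whose address is the value of `e` -/
  | write (a : ℕ) (e f : Expr)
  /-- run `p`, then `q` -/
  | seq (p q : Prog)
  /-- run `p` if the value of `e` is nonzero, and `q` otherwise -/
  | cond (e : Expr) (p q : Prog)
  /-- as long as the value of `e` is nonzero, run `p` -/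
  | loop (e : Expr) (p : Prog)

/-- `Exec p s t s'`: started in the state `s`, the program `p` halts after exactly `t` elementary
steps, in the state `s'`. Besides the evaluation of expressions, each store, each test and each
`skip` is one step. -/
inductive Exec : Prog → State → ℕ → State → Prop where
  | skip (s : State) : Exec .skip s 1 s
  | assign (x : ℕ) (e : Expr) (s : State) :
      Exec (.assign x e) s (e.cost + 1) (s.setReg x (e.eval s))
  | write (a : ℕ) (e f : Expr) (s : State) :
      Exec (.write a e f) s (e.cost + f.cost + 1) (s.setArr a (e.eval s) (f.eval s))
  | seq {p q : Prog} {s s' s'' : State} {t t' : ℕ} :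
      Exec p s t s' → Exec q s' t' s'' → Exec (.seq p q) s (t + t') s''
  | cond_true {e : Expr} {p q : Prog} {s s' : State} {t : ℕ} :
      e.eval s ≠ 0 → Exec p s t s' → Exec (.cond e p q) s (e.cost + 1 + t) s'
  | cond_false {e : Expr} {p q : Prog} {s s' : State} {t : ℕ} :
      e.eval s = 0 → Exec q s t s' → Exec (.cond e p q) s (e.cost + 1 + t) s'
  | loop_true {e : Expr} {p : Prog} {s s' s'' : State} {t t' : ℕ} :
      e.eval s ≠ 0 → Exec p s t s' → Exec (.loop e p) s' t' s'' →
      Exec (.loop e p) s (e.cost + 1 + t + t') s''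
  | loop_false {e : Expr} {p : Prog} {s : State} :
      e.eval s = 0 → Exec (.loop e p) s (e.cost + 1) s

/-- The machine is deterministic: running time and final state are unique. -/
theorem Exec.unique {p : Prog} {s s₁ s₂ : State} {t₁ t₂ : ℕ}
    (h₁ : Exec p s t₁ s₁) (h₂ : Exec p s t₂ s₂) : t₁ = t₂ ∧ s₁ = s₂ := by
  induction h₁ generalizing t₂ s₂ with
  | skip | assign | write => cases h₂; exact ⟨rfl, rfl⟩
  | seq _ _ ih ih' =>
    cases h₂ with
    | seq a b => obtain ⟨rfl, rfl⟩ := ih a; obtain ⟨rfl, rfl⟩ := ih' b; exact ⟨rfl, rfl⟩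
  | cond_true he _ ih =>
    cases h₂ with
    | cond_true _ a => obtain ⟨rfl, rfl⟩ := ih a; exact ⟨rfl, rfl⟩
    | cond_false h _ => exact absurd h he
  | cond_false he _ ih =>
    cases h₂ with
    | cond_true h _ => exact absurd he h
    | cond_false _ a => obtain ⟨rfl, rfl⟩ := ih a; exact ⟨rfl, rfl⟩
  | loop_true he _ _ ih ih' =>
    cases h₂ with
    | loop_true _ a b => obtain ⟨rfl, rfl⟩ := ih a; obtain ⟨rfl, rfl⟩ := ih' b; exact ⟨rfl, rfl⟩
    | loop_false h => exact absurd h he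
  | loop_false he =>
    cases h₂ with
    | loop_true h _ _ => exact absurd he h
    | loop_false _ => exact ⟨rfl, rfl⟩

open Classical in
/-- The initial state for the instance `(G, i, j, k)`, where `G` has the vertices `0, …, n - 1`:
the registers `0, 1, 2, 3` hold `n, i, j, k`, array `0` holds the adjacency matrix of `G` (the
entry for the pair `(u, v)` in cell `u * n + v`), and everything else is zero. -/
noncomputable def inputState {n : ℕ} (G : SimpleGraph (Fin n)) (i j k : ℕ) : State where
  reg x := if x = 0 then n else if x = 1 then i else if x = 2 then j else if x = 3 then k else 0
  arr a m := if a = 0 ∧ ∃ u v : Fin n, G.Adj u v ∧ m = u * n + v then 1 else 0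

/-- On the instance `(G, i, j, k)` the program `p` halts within `T` steps with the correct answer:
register `0` finally holds `1` if `(G, i, j, k)` is a yes-instance, and `0` otherwise. -/
def SolvesWithin (p : Prog) {n : ℕ} (G : SimpleGraph (Fin n)) (i j k T : ℕ) : Prop :=
  ∃ (t : ℕ) (s : State), Exec p (inputState G i j k) t s ∧ t ≤ T ∧
    (IsYes G i j k → s.reg 0 = 1) ∧ (¬ IsYes G i j k → s.reg 0 = 0)

end BFVD

/-!
A complete bipartite graph with two vertices on each side contains a cycle of length four. Pack
disjoint cycles of length four greedily, and let `D` be the set of their vertices. Each feedback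
vertex set meets all cycles of the packing, so `|D| ≤ 4 * fvn G`, and the graph outside `D` has no
cycle of length four (`run_packSt`). Therefore each copy of `K_{i,j}` has a side with at most one
vertex outside `D` (`Sol.no_biclique`), and a set `R` meets all copies if and only if no vertex `a`
is violated, that is, forms a side of a biclique avoiding `R` together with a subset of `D`.

Suppose that the deleted vertices `R` have to be extended by at most `k` further vertices. Let the
core `Z` consist of `D` and the first `k + 1` violated vertices outside `D`. Then it suffices to
branch on the vertices of `Z` and on the first undeleted vertex for each neighbourhood in `Z`
(`exists_cand`). If at most `k` vertices outside `D` are violated, the core contains all of them,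
and vertices with the same neighbourhood in `Z` are interchangeable. If there are more, a solution
disjoint from `Z` contains a neighbour of each of the `k + 1` violated vertices in `Z`, hence a
common neighbour of two of them, which is the only vertex outside `D` with its neighbourhood in `Z`.
There are at most `2 ^ (|D| + k + 2)` candidates (`card_cand_le`), and a guess of `k` digits to this
base determines a sequence of `k` branching steps (`isYes_iff`).

The program tries all guesses. It is written in a small language of bounded summations and bounded
loops, in which candidates and violated vertices are described by explicit formulas. The language
compiles to the machine (`Ex.compile`, `St.compile`), and the running time of a fixed program in it
is polynomial in a bound on the variables, which are the ranges of the loops. The largest range is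
the number `2 ^ ((|D| + k + 2) * k)` of guesses.
-/

namespace BFVD

/-! ### A language of bounded loops and its compilation -/

/-- Arithmetical expressions with bounded summation over named variables. -/
inductive Ex where
  /-- a constant -/
  | const (c : ℕ)
  /-- the value of variable `x` -/
  | var (x : ℕ)
  /-- the cell of array `a` whose address is the value of `e` -/
  | read (a : ℕ) (e : Ex)
  /-- addition -/
  | add (e f : Ex)
  /-- truncated subtraction -/
  | sub (e f : Ex)
  /-- the sum of `e` over all values of the variable `x` below the value of the variable `y` -/
  | sum (x y : ℕ) (e : Ex)

/-- The value of an expression, given the values `ρ` of the variables and the arrays `A`. -/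
def Ex.eval (A : ℕ → ℕ → ℕ) : Ex → (ℕ → ℕ) → ℕ
  | .const c, _ => c
  | .var x, ρ => ρ x
  | .read a e, ρ => A a (e.eval A ρ)
  | .add e f, ρ => e.eval A ρ + f.eval A ρ
  | .sub e f, ρ => e.eval A ρ - f.eval A ρ
  | .sum x y e, ρ => ∑ v ∈ Finset.range (ρ y), e.eval A (Function.update ρ x v)

/-- `e` is well formed in the scope `V`: free variables lie in `V`, bound variables are fresh, and
array `1`, which is reserved for intermediate results, is not used. -/
def Ex.WF : Ex → List ℕ → Prop
  | .const _, _ => True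
  | .var x, V => x ∈ V
  | .read a e, V => a ≠ 1 ∧ e.WF V
  | .add e f, V => e.WF V ∧ f.WF V
  | .sub e f, V => e.WF V ∧ f.WF V
  | .sum x y e, V => x ∉ V ∧ y ∈ V ∧ e.WF (x :: V)

/-- A bound on the time for evaluating an expression when all variables are at most `N`. The
constants leave room for the instructions that move intermediate results and control the loops. -/
def Ex.time (N : ℕ) : Ex → ℕ
  | .const _ => 10
  | .var _ => 10
  | .read _ e => e.time N + 10
  | .add e f => e.time N + f.time N + 10
  | .sub e f => e.time N + f.time N + 10
  | .sum _ _ e => N * (e.time N + 20) + 20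

/-- Statements. They change the arrays only; the variables are loop counters. -/
inductive St where
  /-- do nothing -/
  | skip
  /-- store the value of `f` in the cell of array `a` whose address is the value of `e` -/
  | write (a : ℕ) (e f : Ex)
  /-- run `p`, then `q` -/
  | seq (p q : St)
  /-- run `p` if the value of `e` is nonzero, and `q` otherwise -/
  | ite (e : Ex) (p q : St)
  /-- run `p` for all values of the variable `x` below the value of the variable `y` -/
  | forDo (x y : ℕ) (p : St)

/-- `iter f a m` applies `f 0`, …, `f (m - 1)` in this order, starting from `a`. -/
def iter {α : Type*} (f : ℕ → α → α) (a : α) : ℕ → α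
  | 0 => a
  | m + 1 => f m (iter f a m)

/-- The arrays after running a statement. -/
def St.run : St → (ℕ → ℕ) → (ℕ → ℕ → ℕ) → ℕ → ℕ → ℕ
  | .skip, _, A => A
  | .write a e f, ρ, A => Function.update A a (Function.update (A a) (e.eval A ρ) (f.eval A ρ))
  | .seq p q, ρ, A => q.run ρ (p.run ρ A)
  | .ite e p q, ρ, A => if e.eval A ρ ≠ 0 then p.run ρ A else q.run ρ A
  | .forDo x y p, ρ, A => iter (fun v => p.run (Function.update ρ x v)) A (ρ y)

/-- Well-formedness of statements, as for expressions. -/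
def St.WF : St → List ℕ → Prop
  | .skip, _ => True
  | .write a e f, V => a ≠ 1 ∧ e.WF V ∧ f.WF V
  | .seq p q, V => p.WF V ∧ q.WF V
  | .ite e p q, V => e.WF V ∧ p.WF V ∧ q.WF V
  | .forDo x y p, V => x ∉ V ∧ y ∈ V ∧ p.WF (x :: V)

/-- A bound on the running time of a statement when all variables are at most `N`. -/
def St.time (N : ℕ) : St → ℕ
  | .skip => 1
  | .write _ e f => e.time N + f.time N + 10
  | .seq p q => p.time N + q.time N
  | .ite e p q => e.time N + p.time N + q.time N + 10
  | .forDo _ _ p => N * (p.time N + 20) + 20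

instance Ex.decidableWF : ∀ (e : Ex) (V : List ℕ), Decidable (e.WF V)
  | .const _, _ => .isTrue trivial
  | .var x, V => inferInstanceAs (Decidable (x ∈ V))
  | .read a e, V =>
    have := e.decidableWF V
    inferInstanceAs (Decidable (a ≠ 1 ∧ e.WF V))
  | .add e f, V =>
    have := e.decidableWF V
    have := f.decidableWF V
    inferInstanceAs (Decidable (e.WF V ∧ f.WF V))
  | .sub e f, V =>
    have := e.decidableWF V
    have := f.decidableWF V
    inferInstanceAs (Decidable (e.WF V ∧ f.WF V))
  | .sum x y e, V =>
    have := e.decidableWF (x :: V)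
    inferInstanceAs (Decidable (x ∉ V ∧ y ∈ V ∧ e.WF (x :: V)))

instance St.decidableWF : ∀ (p : St) (V : List ℕ), Decidable (p.WF V)
  | .skip, _ => .isTrue trivial
  | .write a e f, V => inferInstanceAs (Decidable (a ≠ 1 ∧ e.WF V ∧ f.WF V))
  | .seq p q, V =>
    have := p.decidableWF V
    have := q.decidableWF V
    inferInstanceAs (Decidable (p.WF V ∧ q.WF V))
  | .ite e p q, V =>
    have := p.decidableWF V
    have := q.decidableWF V
    inferInstanceAs (Decidable (e.WF V ∧ p.WF V ∧ q.WF V))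
  | .forDo x y p, V =>
    have := p.decidableWF (x :: V)
    inferInstanceAs (Decidable (x ∉ V ∧ y ∈ V ∧ p.WF (x :: V)))

theorem exists_add_le_pow {f g : ℕ → ℕ} (hf : ∃ c, ∀ N, f N ≤ (N + 2) ^ c)
    (hg : ∃ c, ∀ N, g N ≤ (N + 2) ^ c) : ∃ c, ∀ N, f N + g N + 10 ≤ (N + 2) ^ c := by
  obtain ⟨a, ha⟩ := hf
  obtain ⟨b, hb⟩ := hg
  refine ⟨a + b + 4, fun N => ?_⟩
  have h1 : 1 ≤ (N + 2) ^ a := Nat.one_le_pow _ _ (by omega)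
  have h3 : 1 ≤ (N + 2) ^ b := Nat.one_le_pow _ _ (by omega)
  have h4 : 2 ^ 4 ≤ (N + 2) ^ 4 := Nat.pow_le_pow_left (by omega) 4
  have h5 := ha N
  have h6 := hb N
  calc f N + g N + 10 ≤ ((N + 2) ^ a * (N + 2) ^ b) * 16 := by nlinarith
    _ ≤ ((N + 2) ^ a * (N + 2) ^ b) * (N + 2) ^ 4 := Nat.mul_le_mul_left _ h4
    _ = _ := by ring

theorem exists_mul_le_pow {f : ℕ → ℕ} (hf : ∃ c, ∀ N, f N ≤ (N + 2) ^ c) :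
    ∃ c, ∀ N, N * (f N + 20) + 20 ≤ (N + 2) ^ c := by
  obtain ⟨c, hc⟩ := hf
  refine ⟨c + 7, fun N => ?_⟩
  have h1 : 1 ≤ (N + 2) ^ c := Nat.one_le_pow _ _ (by omega)
  have h4 : 2 ^ 6 ≤ (N + 2) ^ 6 := Nat.pow_le_pow_left (by omega) 6
  have h5 := hc N
  calc N * (f N + 20) + 20 ≤ (N + 2) * ((N + 2) ^ c * 64) := by nlinarith
    _ ≤ (N + 2) * ((N + 2) ^ c * (N + 2) ^ 6) := by gcongr; exact h4
    _ = _ := by ring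

/-- The running time of a fixed expression is polynomial in the bound on the variables. -/
theorem Ex.exists_time_le (e : Ex) : ∃ c, ∀ N, e.time N ≤ (N + 2) ^ c := by
  induction e with
  | const _ | var _ =>
    exact ⟨4, fun N => le_trans (by norm_num [Ex.time])
      (Nat.pow_le_pow_left (by omega : 2 ≤ N + 2) 4)⟩
  | read a e ih =>
    simpa [Ex.time] using exists_add_le_pow ih (g := fun _ => 0) ⟨0, by simp⟩
  | add e f ih ih' => exact exists_add_le_pow ih ih'
  | sub e f ih ih' => exact exists_add_le_pow ih ih'
  | sum x y e ih => exact exists_mul_le_pow ih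

/-- The running time of a fixed statement is polynomial in the bound on the variables. -/
theorem St.exists_time_le (p : St) : ∃ c, ∀ N, p.time N ≤ (N + 2) ^ c := by
  induction p with
  | skip => exact ⟨0, fun N => by simp [St.time]⟩
  | write a e f => exact exists_add_le_pow e.exists_time_le f.exists_time_le
  | seq p q ih ih' =>
    obtain ⟨c, hc⟩ := exists_add_le_pow ih ih'
    exact ⟨c, fun N => le_trans (Nat.le_add_right _ 10) (hc N)⟩
  | ite e p q ih ih' =>
    obtain ⟨c, hc⟩ := exists_add_le_pow (exists_add_le_pow e.exists_time_le ih) ih'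
    exact ⟨c, fun N => le_trans (by simp only [St.time]; omega) (hc N)⟩
  | forDo x y p ih => exact exists_mul_le_pow ih

/-- The machine state `s` represents the values `ρ` of the variables in `V` and the arrays `A`. -/
def Agree (V : List ℕ) (ρ : ℕ → ℕ) (A : ℕ → ℕ → ℕ) (s : State) : Prop :=
  (∀ x ∈ V, s.reg x = ρ x) ∧ ∀ a, a ≠ 1 → s.arr a = A a

/-- A loop whose body raises the index `v` of the invariant `I v` until it reaches `m`. -/
theorem exec_loop {e : Expr} {p : Prog} {m T : ℕ} (I : ℕ → State → Prop)
    (hlt : ∀ v s, v < m → I v s → e.eval s ≠ 0) (heq : ∀ s, I m s → e.eval s = 0)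
    (hp : ∀ v s, v < m → I v s → ∃ t s', Exec p s t s' ∧ t ≤ T ∧ I (v + 1) s')
    {s : State} (h0 : I 0 s) :
    ∃ t s', Exec (.loop e p) s t s' ∧ t ≤ m * (T + e.cost + 1) + e.cost + 1 ∧ I m s' := by
  suffices H : ∀ r v s, v + r = m → I v s → ∃ t s', Exec (.loop e p) s t s' ∧
      t ≤ r * (T + e.cost + 1) + e.cost + 1 ∧ I m s' from H m 0 s (by omega) h0
  intro r
  induction r with
  | zero =>
    intro v s hv hI
    obtain rfl : v = m := by omega
    exact ⟨_, s, .loop_false (heq s hI), by omega, hI⟩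
  | succ r ih =>
    intro v s hv hI
    obtain ⟨t, s', h1, h2, h3⟩ := hp v s (by omega) hI
    obtain ⟨t', s'', h4, h5, h6⟩ := ih (v + 1) s' (by omega) h3
    refine ⟨_, s'', .loop_true (hlt v s (by omega) hI) h1 h4, ?_, h6⟩
    rw [Nat.succ_mul]
    omega

/-- The loop that runs `p` for all values of register `x` below the value of register `y`. -/
def forProg (x y : ℕ) (p : Prog) : Prog :=
  .seq (.assign x (.const 0)) (.loop (.sub (.reg y) (.reg x))
    (.seq p (.assign x (.add (.reg x) (.const 1)))))

/-- The body takes the arrays `A v` to `A (v + 1)`, and `J` is an invariant for the state beyond the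
variables in scope and the arrays of the program, such as intermediate results. -/
theorem exec_forProg {x y : ℕ} {p : Prog} {V : List ℕ} {ρ : ℕ → ℕ} {N T : ℕ}
    (hx : x ∉ V) (hy : y ∈ V) (hN : ρ y ≤ N) (A : ℕ → ℕ → ℕ → ℕ) (J : ℕ → State → Prop)
    (hJ : ∀ v s w, J v s → J v (s.setReg x w))
    (hp : ∀ v s, v < ρ y → Agree (x :: V) (Function.update ρ x v) (A v) s → J v s →
      ∃ t s', Exec p s t s' ∧ t ≤ T ∧
        Agree (x :: V) (Function.update ρ x v) (A (v + 1)) s' ∧ J (v + 1) s')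
    {s : State} (hs : Agree V ρ (A 0) s) (h0 : J 0 s) :
    ∃ t s', Exec (forProg x y p) s t s' ∧ t ≤ N * (T + 8) + 6 ∧
      Agree V ρ (A (ρ y)) s' ∧ J (ρ y) s' := by
  have hne : ∀ z ∈ V, z ≠ x := fun z hz h => hx (h ▸ hz)
  have lift : ∀ v B s, Agree V ρ B s → s.reg x = v → Agree (x :: V) (Function.update ρ x v) B s := by
    intro v B s h hv
    refine ⟨fun z hz => ?_, h.2⟩
    rcases List.mem_cons.1 hz with rfl | hz
    · simp [hv]
    · simp [hne z hz, h.1 z hz]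
  have set : ∀ v B s, Agree V ρ B s → Agree V ρ B (s.setReg x v) := fun v B s h =>
    ⟨fun z hz => by simp [State.setReg, hne z hz, h.1 z hz], h.2⟩
  have lower : ∀ v B s, Agree (x :: V) (Function.update ρ x v) B s → Agree V ρ B s ∧ s.reg x = v :=
    fun v B s h => ⟨⟨fun z hz => by simpa [hne z hz] using h.1 z (List.mem_cons_of_mem _ hz), h.2⟩,
      by simpa using h.1 x (by simp)⟩
  obtain ⟨t, s', h1, h2, h3⟩ := exec_loop (e := .sub (.reg y) (.reg x))
    (p := .seq p (.assign x (.add (.reg x) (.const 1)))) (m := ρ y) (T := T + 4)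
    (fun v s => (Agree V ρ (A v) s ∧ s.reg x = v) ∧ J v s)
    (fun v s hv h => by simp [Expr.eval, h.1.2, h.1.1.1 y hy]; omega)
    (fun s h => by simp [Expr.eval, h.1.2, h.1.1.1 y hy])
    (fun v s hv h => by
      obtain ⟨t, s', h1, h2, h3, h4⟩ := hp v s hv (lift v _ s h.1.1 h.1.2) h.2
      obtain ⟨h5, h6⟩ := lower _ _ _ h3
      refine ⟨_, _, .seq h1 (.assign _ _ _), by simp [Expr.cost]; omega, ⟨set _ _ _ h5, ?_⟩,
        hJ _ _ _ h4⟩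
      simp [State.setReg, Expr.eval, h6])
    (s := s.setReg x 0) ⟨⟨set _ _ _ hs, by simp [State.setReg]⟩, hJ _ _ _ h0⟩
  refine ⟨_, s', .seq (.assign _ _ _) h1, ?_, h3.1.1, h3.2⟩
  have h4 : ρ y * (T + 8) ≤ N * (T + 8) := Nat.mul_le_mul_right _ hN
  simp only [Expr.cost] at h2 ⊢
  ring_nf at h2 h4 ⊢
  omega

theorem Agree.setTmp {V : List ℕ} {ρ : ℕ → ℕ} {A : ℕ → ℕ → ℕ} {s : State} (h : Agree V ρ A s)
    (d v : ℕ) : Agree V ρ A (s.setArr 1 d v) :=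
  ⟨h.1, fun a ha => by simp [State.setArr, ha, h.2 a ha]⟩

/-- Expressions compile to programs that leave the value in cell `d` of array `1` and change no
cell of that array below `d`. -/
theorem Ex.compile (e : Ex) : ∀ (V : List ℕ) (d : ℕ), e.WF V → ∃ p : Prog,
    ∀ (N : ℕ) (ρ : ℕ → ℕ) (A : ℕ → ℕ → ℕ) (s : State), (∀ x ∈ V, ρ x ≤ N) → Agree V ρ A s →
      ∃ t s', Exec p s t s' ∧ t ≤ e.time N ∧ Agree V ρ A s' ∧
        (∀ c < d, s'.arr 1 c = s.arr 1 c) ∧ s'.arr 1 d = e.eval A ρ := by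
  induction e with
  | const c =>
    refine fun V d _ => ⟨.write 1 (.const d) (.const c), fun N ρ A s _ h =>
      ⟨_, _, .write _ _ _ _, by simp [Expr.cost, Ex.time], h.setTmp _ _, fun b hb => ?_, ?_⟩⟩
    · simp [State.setArr, Expr.eval, hb.ne]
    · simp [State.setArr, Expr.eval, Ex.eval]
  | var x =>
    refine fun V d hV => ⟨.write 1 (.const d) (.reg x), fun N ρ A s _ h =>
      ⟨_, _, .write _ _ _ _, by simp [Expr.cost, Ex.time], h.setTmp _ _, fun b hb => ?_, ?_⟩⟩
    · simp [State.setArr, Expr.eval, hb.ne]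
    · simp [State.setArr, Expr.eval, Ex.eval, h.1 x hV]
  | read a e ih =>
    intro V d hV
    obtain ⟨p, hp⟩ := ih V d hV.2
    refine ⟨.seq p (.write 1 (.const d) (.read a (.read 1 (.const d)))), fun N ρ A s hN h => ?_⟩
    obtain ⟨t, s', h1, h2, h3, h4, h5⟩ := hp N ρ A s hN h
    refine ⟨_, _, .seq h1 (.write _ _ _ _), ?_, h3.setTmp _ _, fun b hb => ?_, ?_⟩
    · simp [Expr.cost, Ex.time]; omega
    · simp [State.setArr, Expr.eval, hb.ne, h4 b hb]
    · simp [State.setArr, Expr.eval, Ex.eval, h5, h3.2 a hV.1]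
  | add e f ih ih' =>
    intro V d hV
    obtain ⟨p, hp⟩ := ih V d hV.1
    obtain ⟨q, hq⟩ := ih' V (d + 1) hV.2
    refine ⟨.seq p (.seq q (.write 1 (.const d)
      (.add (.read 1 (.const d)) (.read 1 (.const (d + 1)))))), fun N ρ A s hN h => ?_⟩
    obtain ⟨t, s', h1, h2, h3, h4, h5⟩ := hp N ρ A s hN h
    obtain ⟨t', s'', h1', h2', h3', h4', h5'⟩ := hq N ρ A s' hN h3
    refine ⟨_, _, .seq h1 (.seq h1' (.write _ _ _ _)), ?_, h3'.setTmp _ _, fun b hb => ?_, ?_⟩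
    · simp [Expr.cost, Ex.time]; omega
    · simp [State.setArr, Expr.eval, hb.ne, h4 b hb, h4' b (by omega)]
    · simp [State.setArr, Expr.eval, Ex.eval, h5, h5', h4' d (by omega)]
  | sub e f ih ih' =>
    intro V d hV
    obtain ⟨p, hp⟩ := ih V d hV.1
    obtain ⟨q, hq⟩ := ih' V (d + 1) hV.2
    refine ⟨.seq p (.seq q (.write 1 (.const d)
      (.sub (.read 1 (.const d)) (.read 1 (.const (d + 1)))))), fun N ρ A s hN h => ?_⟩
    obtain ⟨t, s', h1, h2, h3, h4, h5⟩ := hp N ρ A s hN h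
    obtain ⟨t', s'', h1', h2', h3', h4', h5'⟩ := hq N ρ A s' hN h3
    refine ⟨_, _, .seq h1 (.seq h1' (.write _ _ _ _)), ?_, h3'.setTmp _ _, fun b hb => ?_, ?_⟩
    · simp [Expr.cost, Ex.time]; omega
    · simp [State.setArr, Expr.eval, hb.ne, h4 b hb, h4' b (by omega)]
    · simp [State.setArr, Expr.eval, Ex.eval, h5, h5', h4' d (by omega)]
  | sum x y e ih =>
    intro V d hV
    obtain ⟨p, hp⟩ := ih (x :: V) (d + 1) hV.2.2
    refine ⟨.seq (.write 1 (.const d) (.const 0)) (forProg x y (.seq p (.write 1 (.const d)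
      (.add (.read 1 (.const d)) (.read 1 (.const (d + 1))))))), fun N ρ A s hN h => ?_⟩
    obtain ⟨t, s', h1, h2, h3, h4, h5⟩ := exec_forProg (p := .seq p (.write 1 (.const d)
      (.add (.read 1 (.const d)) (.read 1 (.const (d + 1)))))) (T := e.time N + 8)
      hV.1 hV.2.1 (hN y hV.2.1) (fun _ => A)
      (fun v s' => (∀ c < d, s'.arr 1 c = s.arr 1 c) ∧
        s'.arr 1 d = ∑ w ∈ Finset.range v, e.eval A (Function.update ρ x w))
      (fun v s w hs => hs)
      (fun v s₁ hv hA hJ => by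
        have hN' : ∀ z ∈ x :: V, Function.update ρ x v z ≤ N := by
          intro z hz
          rcases eq_or_ne z x with rfl | hzx
          · simpa using hv.le.trans (hN y hV.2.1)
          · simpa [hzx] using hN z ((List.mem_cons.1 hz).resolve_left hzx)
        obtain ⟨t, s', h1, h2, h3, h4, h5⟩ := hp N _ A s₁ hN' hA
        refine ⟨_, _, .seq h1 (.write _ _ _ _), by simp [Expr.cost]; omega, h3.setTmp _ _,
          fun b hb => ?_, ?_⟩
        · simp [State.setArr, Expr.eval, hb.ne, h4 b (by omega), hJ.1 b hb]
        · simp [State.setArr, Expr.eval, h5, h4 d (by omega), hJ.2, Finset.sum_range_succ])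
      (s := s.setArr 1 d 0) (h.setTmp _ _)
      ⟨fun b hb => by simp [State.setArr, hb.ne], by simp [State.setArr]⟩
    refine ⟨_, s', .seq (.write _ _ _ _) h1, ?_, h3, h4, h5⟩
    simp only [Expr.cost, Ex.time]
    ring_nf at h2 ⊢
    omega

/-- Statements compile to programs of the machine. -/
theorem St.compile (p : St) : ∀ (V : List ℕ), p.WF V → ∃ P : Prog,
    ∀ (N : ℕ) (ρ : ℕ → ℕ) (A : ℕ → ℕ → ℕ) (s : State), (∀ x ∈ V, ρ x ≤ N) → Agree V ρ A s →
      ∃ t s', Exec P s t s' ∧ t ≤ p.time N ∧ Agree V ρ (p.run ρ A) s' := by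
  induction p with
  | skip => exact fun V _ => ⟨.skip, fun N ρ A s _ h => ⟨_, _, .skip _, le_rfl, h⟩⟩
  | write a e f =>
    intro V hV
    obtain ⟨p, hp⟩ := e.compile V 0 hV.2.1
    obtain ⟨q, hq⟩ := f.compile V 1 hV.2.2
    refine ⟨.seq p (.seq q (.write a (.read 1 (.const 0)) (.read 1 (.const 1)))),
      fun N ρ A s hN h => ?_⟩
    obtain ⟨t, s', h1, h2, h3, h4, h5⟩ := hp N ρ A s hN h
    obtain ⟨t', s'', h1', h2', h3', h4', h5'⟩ := hq N ρ A s' hN h3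
    refine ⟨_, _, .seq h1 (.seq h1' (.write _ _ _ _)), ?_, h3'.1, fun b hb => ?_⟩
    · simp [Expr.cost, St.time]; omega
    · rcases eq_or_ne b a with rfl | hba
      · simp [State.setArr, Expr.eval, St.run, h5', h4' 0 (by omega), h5, h3'.2 b hb]
      · simp [State.setArr, St.run, hba, h3'.2 b hb]
  | seq p q ih ih' =>
    intro V hV
    obtain ⟨P, hP⟩ := ih V hV.1
    obtain ⟨Q, hQ⟩ := ih' V hV.2
    refine ⟨.seq P Q, fun N ρ A s hN h => ?_⟩
    obtain ⟨t, s', h1, h2, h3⟩ := hP N ρ A s hN h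
    obtain ⟨t', s'', h1', h2', h3'⟩ := hQ N ρ _ s' hN h3
    exact ⟨_, _, .seq h1 h1', Nat.add_le_add h2 h2', h3'⟩
  | ite e p q ih ih' =>
    intro V hV
    obtain ⟨E, hE⟩ := e.compile V 0 hV.1
    obtain ⟨P, hP⟩ := ih V hV.2.1
    obtain ⟨Q, hQ⟩ := ih' V hV.2.2
    refine ⟨.seq E (.cond (.read 1 (.const 0)) P Q), fun N ρ A s hN h => ?_⟩
    obtain ⟨t, s', h1, h2, h3, h4, h5⟩ := hE N ρ A s hN h
    by_cases he : e.eval A ρ = 0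
    · obtain ⟨t', s'', h1', h2', h3'⟩ := hQ N ρ _ s' hN h3
      refine ⟨_, _, .seq h1 (.cond_false (by simp [Expr.eval, h5, he]) h1'), ?_, ?_⟩
      · simp [Expr.cost, St.time]; omega
      · simpa [St.run, he] using h3'
    · obtain ⟨t', s'', h1', h2', h3'⟩ := hP N ρ _ s' hN h3
      refine ⟨_, _, .seq h1 (.cond_true (by simp [Expr.eval, h5, he]) h1'), ?_, ?_⟩
      · simp [Expr.cost, St.time]; omega
      · simpa [St.run, he] using h3'
  | forDo x y p ih =>
    intro V hV
    obtain ⟨P, hP⟩ := ih (x :: V) hV.2.2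
    refine ⟨forProg x y P, fun N ρ A s hN h => ?_⟩
    obtain ⟨t, s', h1, h2, h3, -⟩ := exec_forProg (p := P) (T := p.time N)
      hV.1 hV.2.1 (hN y hV.2.1) (iter (fun v => p.run (Function.update ρ x v)) A)
      (fun _ _ => True) (fun _ _ _ _ => trivial)
      (fun v s₁ hv hA _ => by
        have hN' : ∀ z ∈ x :: V, Function.update ρ x v z ≤ N := by
          intro z hz
          rcases eq_or_ne z x with rfl | hzx
          · simpa using hv.le.trans (hN y hV.2.1)
          · simpa [hzx] using hN z ((List.mem_cons.1 hz).resolve_left hzx)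
        obtain ⟨t, s', h1, h2, h3⟩ := hP N _ _ s₁ hN' hA
        exact ⟨t, s', h1, h2, h3, trivial⟩) h trivial
    refine ⟨t, s', h1, ?_, h3⟩
    simp only [St.time]
    ring_nf at h2 ⊢
    omega

end BFVD

namespace BFVD

/-! ### Formulas -/

namespace Ex

/-- Negation. Expressions serve as formulas, nonzero values counting as true. -/
def notE (e : Ex) : Ex := .sub (.const 1) e
/-- Conjunction. -/
def andE (e f : Ex) : Ex := notE (.add (notE e) (notE f))
/-- Disjunction. -/
def orE (e f : Ex) : Ex := .add e f
/-- Implication. -/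
def impE (e f : Ex) : Ex := orE (notE e) f
/-- Equivalence. -/
def iffE (e f : Ex) : Ex := andE (impE e f) (impE f e)
/-- `e ≤ f`. -/
def leE (e f : Ex) : Ex := notE (.sub e f)
/-- `e < f`. -/
def ltE (e f : Ex) : Ex := .sub f e
/-- `e = f`. -/
def eqE (e f : Ex) : Ex := andE (leE e f) (leE f e)
/-- Bounded existential quantification over the variable `x`. -/
def exE (x y : ℕ) (e : Ex) : Ex := .sum x y e
/-- Bounded universal quantification over the variable `x`. -/
def allE (x y : ℕ) (e : Ex) : Ex := notE (exE x y (notE e))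
/-- The number of values of the variable `x` for which `e` is true. -/
def cntE (x y : ℕ) (e : Ex) : Ex := .sum x y (notE (notE e))

/-- The truth value of a formula. -/
def T (A : ℕ → ℕ → ℕ) (e : Ex) (ρ : ℕ → ℕ) : Prop := e.eval A ρ ≠ 0

variable {A : ℕ → ℕ → ℕ} {ρ : ℕ → ℕ} {e f : Ex} {x y c a : ℕ}

@[simp] theorem eval_const : (const c).eval A ρ = c := rfl
@[simp] theorem eval_var : (var x).eval A ρ = ρ x := rfl
@[simp] theorem eval_read : (read a e).eval A ρ = A a (e.eval A ρ) := rfl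
@[simp] theorem eval_add : (add e f).eval A ρ = e.eval A ρ + f.eval A ρ := rfl
@[simp] theorem eval_sub : (sub e f).eval A ρ = e.eval A ρ - f.eval A ρ := rfl
@[simp] theorem eval_sum : (sum x y e).eval A ρ =
    ∑ v ∈ Finset.range (ρ y), e.eval A (Function.update ρ x v) := rfl

@[simp] theorem T_read : T A (read a e) ρ ↔ A a (e.eval A ρ) ≠ 0 := Iff.rfl
@[simp] theorem T_notE : T A (notE e) ρ ↔ ¬ T A e ρ := by simp [T, notE]; omega
@[simp] theorem T_andE : T A (andE e f) ρ ↔ T A e ρ ∧ T A f ρ := by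
  simp [T, notE, andE]; omega
@[simp] theorem T_orE : T A (orE e f) ρ ↔ T A e ρ ∨ T A f ρ := by
  simp [T, orE]; omega
@[simp] theorem T_impE : T A (impE e f) ρ ↔ (T A e ρ → T A f ρ) := by
  simp [impE, imp_iff_not_or]
@[simp] theorem T_iffE : T A (iffE e f) ρ ↔ (T A e ρ ↔ T A f ρ) := by
  simp [iffE, iff_def]
@[simp] theorem T_leE : T A (leE e f) ρ ↔ e.eval A ρ ≤ f.eval A ρ := by
  rw [leE, T_notE, T, eval_sub]; omega
@[simp] theorem T_ltE : T A (ltE e f) ρ ↔ e.eval A ρ < f.eval A ρ := by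
  rw [ltE, T, eval_sub]; omega
@[simp] theorem T_eqE : T A (eqE e f) ρ ↔ e.eval A ρ = f.eval A ρ := by
  simp [eqE, le_antisymm_iff]
@[simp] theorem T_exE : T A (exE x y e) ρ ↔ ∃ v < ρ y, T A e (Function.update ρ x v) := by
  simp [exE, T]
@[simp] theorem T_allE : T A (allE x y e) ρ ↔ ∀ v < ρ y, T A e (Function.update ρ x v) := by
  simp [allE]
open Classical in
@[simp] theorem eval_cntE : (cntE x y e).eval A ρ =
    {v ∈ Finset.range (ρ y) | T A e (Function.update ρ x v)}.card := by
  simp only [cntE, eval_sum, Finset.card_filter]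
  refine Finset.sum_congr rfl fun v _ => ?_
  by_cases h : e.eval A (Function.update ρ x v) = 0
  · simp [notE, T, h]
  · simp only [notE, eval_sub, eval_const, T, ne_eq, h, not_false_eq_true, if_true]
    omega

/-! The variables `0` and `3` hold `n` and `k`; the variable `4` holds the number of subsets of `D`,
and the variables `5` and `6` hold the bound on the number of candidates and the number of guesses.
Array `0` is the adjacency matrix. The arrays `2` and `3` hold the characteristic functions of `D`
and of the set `R` of deleted vertices, and cell `v` of array `4` holds `2 ^ r`, where `r` is the
number of elements of `D` below `v`. Array `5` holds the current guess, and array `9` holds `i` and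
`j`, which are not kept in variables because they are not bounded in terms of the running time. -/

/-- The vertices `x` and `y` are adjacent. -/
def adjE (x y : ℕ) : Ex := .read 0 (.add (.sum 50 x (.var 0)) (.var y))
/-- The vertex `x` lies in `D`. -/
def inD (x : ℕ) : Ex := .read 2 (.var x)
/-- The vertex `x` has been deleted. -/
def inR (x : ℕ) : Ex := .read 3 (.var x)
/-- The vertex `12` lies in the subset of `D` with code `11`: the binary digit of the code at the
position given by array `4` is `1`. -/
def inCode : Ex := andE (inD 12) (exE 51 11 (exE 52 11 (andE (ltE (.var 52) (.read 4 (.var 12)))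
  (eqE (.var 11) (.add (.sum 53 51 (.add (.read 4 (.var 12)) (.read 4 (.var 12))))
    (.add (.read 4 (.var 12)) (.var 52)))))))
/-- The vertex `12` is the vertex `10` or lies in the subset of `D` with code `11`. -/
def inSide : Ex := orE (eqE (.var 12) (.var 10)) inCode
/-- The size of the side given by `10` and `11`. -/
def sideCard : Ex := cntE 12 0 inSide
/-- The number of undeleted common neighbours of the side given by `10` and `11`. -/
def nbrCard : Ex := cntE 13 0 (andE (notE (inR 13)) (allE 12 0 (impE inSide (adjE 12 13))))
/-- The vertex `10` and a subset of `D` form a side of a biclique without deleted vertices. -/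
def violE : Ex := exE 11 4 (andE (allE 12 0 (impE inSide (notE (inR 12))))
  (orE (andE (leE (.read 9 (.const 0)) sideCard) (leE (.read 9 (.const 1)) nbrCard))
    (andE (leE (.read 9 (.const 1)) sideCard) (leE (.read 9 (.const 0)) nbrCard))))
/-- The deleted vertices meet all bicliques. -/
def solE : Ex := allE 10 0 (notE violE)
/-- The vertex `10` is a violated centre. -/
def centE : Ex := andE (notE (inD 10)) violE
/-- The vertex `14` lies in `D` or is one of the first `k + 1` violated centres. -/
def coreE : Ex := orE (inD 14) (andE (exE 10 0 (andE (eqE (.var 10) (.var 14)) centE))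
  (leE (cntE 10 0 (andE (ltE (.var 10) (.var 14)) centE)) (.var 3)))
/-- The vertex `x` lies in the core. -/
def coreAt (x : ℕ) : Ex := exE 14 0 (andE (eqE (.var 14) (.var x)) coreE)
/-- The vertex `16` is the first undeleted vertex with its neighbourhood in the core. -/
def repE : Ex := andE (notE (inR 16)) (allE 15 0 (impE (ltE (.var 15) (.var 16))
  (notE (andE (notE (inR 15)) (andE (notE (coreAt 15))
    (allE 14 0 (impE coreE (iffE (adjE 15 14) (adjE 16 14)))))))))
/-- The vertex `16` is a candidate for deletion. -/
def candE : Ex := orE (coreAt 16) repE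
/-- The quotient of the current guess by the bound on the number of candidates, as the number of
`h` with `(h + 1) * M ≤ g`. -/
def quotE : Ex := cntE 18 6 (leE (.add (.sum 19 18 (.var 5)) (.var 5)) (.read 5 (.const 0)))
/-- The last digit of the current guess. -/
def digitE : Ex := .sub (.read 5 (.const 0)) (.sum 20 5 quotE)
/-- The candidate whose rank among the candidates is the last digit of the current guess. -/
def choiceE : Ex := cntE 17 0 (leE (cntE 16 0 (andE (leE (.var 16) (.var 17)) candE)) digitE)

end Ex

open Ex

/-! ### The meaning of the formulas -/

section Semantics

open Classical in
/-- The undeleted common neighbours of `S`. -/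
noncomputable def nbrs (H : SimpleGraph ℕ) (n : ℕ) (S R : Finset ℕ) : Finset ℕ :=
  {w ∈ Finset.range n | w ∉ R ∧ ∀ v ∈ S, H.Adj v w}

/-- `S` is (a superset of) a side of a biclique `K_{i,j}` without vertices in `R`. -/
def Side (H : SimpleGraph ℕ) (n i j : ℕ) (S R : Finset ℕ) : Prop :=
  Disjoint S R ∧ (i ≤ S.card ∧ j ≤ (nbrs H n S R).card ∨ j ≤ S.card ∧ i ≤ (nbrs H n S R).card)

/-- The vertex `a` is violated: together with a subset of `D` it forms a side of a biclique that
avoids `R`. -/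
def Viol (H : SimpleGraph ℕ) (n i j : ℕ) (D R : Finset ℕ) (a : ℕ) : Prop :=
  ∃ S ⊆ D, Side H n i j (insert a S) R

open Classical in
/-- The first `k + 1` violated vertices outside `D`, together with `D`. -/
noncomputable def core (H : SimpleGraph ℕ) (n i j k : ℕ) (D R : Finset ℕ) : Finset ℕ :=
  {v ∈ Finset.range n | v ∈ D ∨ (v ∉ D ∧ Viol H n i j D R v) ∧
    {u ∈ Finset.range n | u < v ∧ u ∉ D ∧ Viol H n i j D R u}.card ≤ k}

/-- `v` is the first undeleted vertex outside `Z` with its neighbourhood in `Z`. -/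
def Rep (H : SimpleGraph ℕ) (Z R : Finset ℕ) (v : ℕ) : Prop :=
  v ∉ R ∧ ∀ u < v, ¬ (u ∉ R ∧ u ∉ Z ∧ ∀ z ∈ Z, (H.Adj u z ↔ H.Adj v z))

open Classical in
/-- The candidates for deletion, in a solution that extends `R`. -/
noncomputable def cand (H : SimpleGraph ℕ) (n i j k : ℕ) (D R : Finset ℕ) : Finset ℕ :=
  {v ∈ Finset.range n | v ∈ core H n i j k D R ∨ Rep H (core H n i j k D R) R v}

/-- The subset of `D` with code `m`. -/
def codeSet (D : Finset ℕ) (m : ℕ) : Finset ℕ :=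
  {v ∈ D | m.testBit (Nat.count (· ∈ D) v)}

theorem codeSet_subset (D : Finset ℕ) (m : ℕ) : codeSet D m ⊆ D := Finset.filter_subset _ _

theorem exists_codeSet {D S : Finset ℕ} (hS : S ⊆ D) : ∃ m < 2 ^ D.card, codeSet D m = S := by
  refine ⟨Nat.ofBits (fun r : Fin D.card => decide (Nat.nth (· ∈ D) r ∈ S)), Nat.ofBits_lt_two_pow _,
    ?_⟩
  ext v
  simp only [codeSet, Finset.mem_filter]
  constructor
  · rintro ⟨hv, h⟩
    have hlt : Nat.count (· ∈ D) v < D.card := by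
      by_contra hc
      rw [Nat.testBit_ofBits_ge _ _ (not_lt.1 hc)] at h
      simp at h
    rw [Nat.testBit_ofBits_lt _ _ hlt] at h
    simpa [Nat.nth_count (p := (· ∈ D)) hv] using h
  · intro hv
    have hvD := hS hv
    have hlt : Nat.count (· ∈ D) v < D.card := by
      have h1 : Nat.count (· ∈ D) v < Nat.count (· ∈ D) (v + 1) := by
        simp [Nat.count_succ, hvD]
      refine h1.trans_le ?_
      rw [Nat.count_eq_card_filter_range]
      exact Finset.card_le_card fun w hw => (Finset.mem_filter.1 hw).2
    refine ⟨hvD, ?_⟩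
    rw [Nat.testBit_ofBits_lt _ _ hlt]
    simpa [Nat.nth_count (p := (· ∈ D)) hvD] using hv

/-- The description of binary digits that underlies `Ex.inCode`: it needs no division, and the
variables in it are bounded by `m`. -/
theorem testBit_iff_exists {m r : ℕ} : m.testBit r = true ↔
    ∃ h < m, ∃ l < m, l < 2 ^ r ∧ m = h * (2 ^ r + 2 ^ r) + (2 ^ r + l) := by
  have hP : 0 < 2 ^ r := by positivity
  rw [Nat.testBit_eq_decide_div_mod_eq, decide_eq_true_iff]
  constructor
  · intro h
    have h1 := Nat.div_add_mod m (2 ^ r)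
    have h2 := Nat.div_add_mod (m / 2 ^ r) 2
    have h3 := Nat.mod_lt m hP
    rw [h] at h2
    set q := m / 2 ^ r / 2
    have h4 : m = q * (2 ^ r + 2 ^ r) + (2 ^ r + m % 2 ^ r) := by
      rw [← h2] at h1
      linarith
    have h5 : q ≤ q * (2 ^ r + 2 ^ r) := Nat.le_mul_of_pos_right _ (by omega)
    exact ⟨q, by omega, m % 2 ^ r, by omega, h3, h4⟩
  · rintro ⟨h, -, l, -, hl, rfl⟩
    have : (h * (2 ^ r + 2 ^ r) + (2 ^ r + l)) / 2 ^ r = 2 * h + 1 := by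
      rw [show h * (2 ^ r + 2 ^ r) + (2 ^ r + l) = l + 2 ^ r * (2 * h + 1) by ring,
        Nat.add_mul_div_left _ _ hP, Nat.div_eq_of_lt hl, zero_add]
    rw [this]
    omega

/-- The arrays and variables represent the graph `H` on `{0, …, n - 1}`, the numbers `i`, `j`, `k`,
and the set `D`. -/
structure Encodes (H : SimpleGraph ℕ) (n i j k : ℕ) (D : Finset ℕ) (ρ : ℕ → ℕ) (A : ℕ → ℕ → ℕ) :
    Prop where
  var_n : ρ 0 = n
  cell_i : A 9 0 = i
  cell_j : A 9 1 = j
  var_k : ρ 3 = k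
  var_w : ρ 4 = 2 ^ D.card
  adj : ∀ u < n, ∀ v < n, (A 0 (u * n + v) ≠ 0 ↔ H.Adj u v)
  mem : ∀ v < n, (A 2 v ≠ 0 ↔ v ∈ D)
  pow : ∀ v < n, A 4 v = 2 ^ Nat.count (· ∈ D) v

/-- Array `3` represents the set `R`. -/
def EncodesR (n : ℕ) (R : Finset ℕ) (A : ℕ → ℕ → ℕ) : Prop := ∀ v < n, (A 3 v ≠ 0 ↔ v ∈ R)

variable {H : SimpleGraph ℕ} {n i j k : ℕ} {D R : Finset ℕ} {ρ : ℕ → ℕ} {A : ℕ → ℕ → ℕ}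

theorem Encodes.update (h : Encodes H n i j k D ρ A) {x : ℕ} (hx : 4 < x) (v : ℕ) :
    Encodes H n i j k D (Function.update ρ x v) A := by
  obtain ⟨h0, h1, h2, h3, h4, h5, h6, h7⟩ := h
  constructor <;> first | assumption | (rw [Function.update_of_ne (by omega)]; assumption)

theorem T_adjE (h : Encodes H n i j k D ρ A) {x y : ℕ} (hx : ρ x < n) (hy : ρ y < n) :
    T A (adjE x y) ρ ↔ H.Adj (ρ x) (ρ y) := by
  rw [adjE, T_read, ← h.adj _ hx _ hy]
  simp [h.var_n]

theorem T_inSide (h : Encodes H n i j k D ρ A) (h12 : ρ 12 < n) :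
    T A inSide ρ ↔ ρ 12 ∈ insert (ρ 10) (codeSet D (ρ 11)) := by
  simp only [inSide, inCode, T_orE, T_eqE, T_andE, inD, T_read, T_exE, T_ltE, eval_read, eval_var,
    eval_add, eval_sum, h.mem _ h12, Finset.mem_insert, codeSet, Finset.mem_filter,
    testBit_iff_exists]
  simp [h.pow _ h12]

theorem eval_sideCard (h : Encodes H n i j k D ρ A) (hD : D ⊆ Finset.range n) (h10 : ρ 10 < n) :
    sideCard.eval A ρ = (insert (ρ 10) (codeSet D (ρ 11))).card := by
  classical
  rw [sideCard, eval_cntE]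
  congr 1
  ext v
  simp only [Finset.mem_filter, Finset.mem_range, h.var_n]
  constructor
  · rintro ⟨hv, h1⟩
    rw [T_inSide (h.update (by norm_num) _) (by simpa using hv)] at h1
    simpa using h1
  · intro h1
    have hv : v < n := by
      rcases Finset.mem_insert.1 h1 with rfl | h2
      · exact h10
      · exact Finset.mem_range.1 (hD (codeSet_subset _ _ h2))
    refine ⟨hv, ?_⟩
    rw [T_inSide (h.update (by norm_num) _) (by simpa using hv)]
    simpa using h1

theorem forall_inSide (h : Encodes H n i j k D ρ A) (hD : D ⊆ Finset.range n) (h10 : ρ 10 < n)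
    {e : Ex} {P : ℕ → Prop}
    (he : ∀ v < n, (T A e (Function.update ρ 12 v) ↔ P v)) :
    T A (allE 12 0 (impE inSide e)) ρ ↔ ∀ v ∈ insert (ρ 10) (codeSet D (ρ 11)), P v := by
  rw [T_allE, h.var_n]
  constructor
  · intro h1 v hv
    have hvn : v < n := by
      rcases Finset.mem_insert.1 hv with rfl | h2
      · exact h10
      · exact Finset.mem_range.1 (hD (codeSet_subset _ _ h2))
    have h2 := h1 v hvn
    rw [T_impE, T_inSide (h.update (by norm_num) _) (by simpa using hvn), he v hvn] at h2
    exact h2 (by simpa using hv)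
  · intro h1 v hvn
    rw [T_impE, T_inSide (h.update (by norm_num) _) (by simpa using hvn), he v hvn]
    exact fun h2 => h1 v (by simpa using h2)

theorem T_violE (h : Encodes H n i j k D ρ A) (hR : EncodesR n R A) (hD : D ⊆ Finset.range n)
    (h10 : ρ 10 < n) : T A violE ρ ↔ Viol H n i j D R (ρ 10) := by
  classical
  have key : ∀ m, T A (andE (allE 12 0 (impE inSide (notE (inR 12))))
      (orE (andE (leE (.read 9 (.const 0)) sideCard) (leE (.read 9 (.const 1)) nbrCard))
        (andE (leE (.read 9 (.const 1)) sideCard) (leE (.read 9 (.const 0)) nbrCard)))) (Function.update ρ 11 m) ↔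
      Side H n i j (insert (ρ 10) (codeSet D m)) R := by
    intro m
    have h' := h.update (x := 11) (by norm_num) m
    have h10' : Function.update ρ 11 m 10 < n := by simpa using h10
    have hcard : nbrCard.eval A (Function.update ρ 11 m) =
        (nbrs H n (insert (ρ 10) (codeSet D m)) R).card := by
      rw [nbrCard, eval_cntE, nbrs, h'.var_n]
      congr 1
      refine Finset.filter_congr fun w hw => ?_
      have hw' : w < n := Finset.mem_range.1 hw
      have h'' := h'.update (x := 13) (by norm_num) w
      rw [T_andE, forall_inSide h'' hD (by simpa using h10)
        (P := fun v => H.Adj v w)]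
      · simp [inR, hR w hw']
      · intro v hv
        rw [T_adjE (h''.update (by norm_num) v) (by simpa using hv)
          (by simpa using hw')]
        simp
    simp only [T_andE, T_orE, T_leE, eval_sideCard h' hD h10', hcard, eval_read, eval_const, h'.cell_i, h'.cell_j,
      forall_inSide h' hD h10' (e := notE (inR 12)) (P := fun v => v ∉ R)
        (fun v hv => by simp [inR, hR v hv])]
    simp [Side, Finset.disjoint_left]
  simp only [violE, T_exE, key, h.var_w, Viol]
  constructor
  · rintro ⟨m, -, hm⟩
    exact ⟨_, codeSet_subset _ _, hm⟩
  · rintro ⟨S, hS, h1⟩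
    obtain ⟨m, hm, rfl⟩ := exists_codeSet hS
    exact ⟨m, hm, h1⟩

theorem T_solE (h : Encodes H n i j k D ρ A) (hR : EncodesR n R A) (hD : D ⊆ Finset.range n) :
    T A solE ρ ↔ ∀ a < n, ¬ Viol H n i j D R a := by
  rw [solE, T_allE, h.var_n]
  refine forall₂_congr fun a ha => ?_
  rw [T_notE, T_violE (h.update (by norm_num) a) hR hD (by simpa using ha)]
  simp

theorem T_centE (h : Encodes H n i j k D ρ A) (hR : EncodesR n R A) (hD : D ⊆ Finset.range n)
    (h10 : ρ 10 < n) : T A centE ρ ↔ ρ 10 ∉ D ∧ Viol H n i j D R (ρ 10) := by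
  rw [centE, T_andE, T_violE h hR hD h10, T_notE, inD, T_read, eval_var, h.mem _ h10]

theorem T_coreE (h : Encodes H n i j k D ρ A) (hR : EncodesR n R A) (hD : D ⊆ Finset.range n)
    (h14 : ρ 14 < n) : T A coreE ρ ↔ ρ 14 ∈ core H n i j k D R := by
  classical
  have h1 : T A (exE 10 0 (andE (eqE (.var 10) (.var 14)) centE)) ρ ↔
      ρ 14 ∉ D ∧ Viol H n i j D R (ρ 14) := by
    rw [T_exE, h.var_n]
    constructor
    · rintro ⟨v, hv, h1⟩
      rw [T_andE, T_centE (h.update (by norm_num) v) hR hD (by simpa using hv)] at h1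
      simp at h1
      obtain ⟨rfl, h1⟩ := h1
      exact h1
    · intro h1
      refine ⟨ρ 14, h14, ?_⟩
      rw [T_andE, T_centE (h.update (by norm_num) _) hR hD (by simpa using h14)]
      simpa using h1
  have h2 : (cntE 10 0 (andE (ltE (.var 10) (.var 14)) centE)).eval A ρ =
      {u ∈ Finset.range n | u < ρ 14 ∧ u ∉ D ∧ Viol H n i j D R u}.card := by
    rw [eval_cntE, h.var_n]
    congr 1
    refine Finset.filter_congr fun u hu => ?_
    rw [T_andE, T_centE (h.update (by norm_num) u) hR hD (by simpa using hu)]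
    simp
  rw [coreE, T_orE, T_andE, h1, T_leE, h2, inD, T_read, eval_var, h.mem _ h14, eval_var, h.var_k, core]
  simp [h14]

theorem T_coreAt (h : Encodes H n i j k D ρ A) (hR : EncodesR n R A) (hD : D ⊆ Finset.range n) {x : ℕ}
    (hx : ρ x < n) (hx' : x ≠ 14 := by decide) :
    T A (coreAt x) ρ ↔ ρ x ∈ core H n i j k D R := by
  rw [coreAt, T_exE, h.var_n]
  constructor
  · rintro ⟨v, hv, h1⟩
    rw [T_andE, T_coreE (h.update (by norm_num) v) hR hD (by simpa using hv)] at h1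
    simp [hx'] at h1
    obtain ⟨rfl, h1⟩ := h1
    exact h1
  · intro h1
    refine ⟨ρ x, hx, ?_⟩
    rw [T_andE, T_coreE (h.update (by norm_num) _) hR hD (by simpa using hx)]
    simpa [hx'] using h1

theorem core_subset : core H n i j k D R ⊆ Finset.range n := by
  classical exact Finset.filter_subset _ _

theorem T_candE (h : Encodes H n i j k D ρ A) (hR : EncodesR n R A) (hD : D ⊆ Finset.range n)
    (h16 : ρ 16 < n) : T A candE ρ ↔ ρ 16 ∈ cand H n i j k D R := by
  have h1 : T A repE ρ ↔ Rep H (core H n i j k D R) R (ρ 16) := by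
    rw [repE, T_andE, T_notE, inR, T_read, eval_var, hR _ h16, T_allE, Rep, h.var_n]
    refine and_congr_right fun _ => ⟨fun h2 u hu => ?_, fun h2 u hu => ?_⟩
    all_goals
      have hu' : u < n := by omega
      have h' := h.update (x := 15) (by norm_num) u
      have h3 : T A (allE 14 0 (impE coreE (iffE (adjE 15 14) (adjE 16 14))))
          (Function.update ρ 15 u) ↔
          ∀ z ∈ core H n i j k D R, (H.Adj u z ↔ H.Adj (ρ 16) z) := by
        rw [T_allE, h'.var_n]
        have h4 : ∀ z < n, T A (impE coreE (iffE (adjE 15 14) (adjE 16 14)))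
            (Function.update (Function.update ρ 15 u) 14 z) ↔
            (z ∈ core H n i j k D R → (H.Adj u z ↔ H.Adj (ρ 16) z)) := by
          intro z hz
          have h'' := h'.update (x := 14) (by norm_num) z
          rw [T_impE, T_iffE, T_coreE h'' hR hD (by simpa using hz),
            T_adjE h'' (by simpa using hu')
              (by simpa using hz),
            T_adjE h'' (by simpa using h16)
              (by simpa using hz)]
          simp
        exact ⟨fun h5 z hz => (h4 z (Finset.mem_range.1 (core_subset hz))).1
          (h5 z (Finset.mem_range.1 (core_subset hz))) hz, fun h5 z hz => (h4 z hz).2 (h5 z)⟩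
    · have h4 := h2 u hu'
      rw [T_impE, T_notE, T_andE, T_andE, h3, T_notE, T_notE,
        T_coreAt h' hR hD (by simpa using hu'), inR, T_read, eval_var] at h4
      simp only [T_ltE, eval_var, Function.update_self, hR u hu'] at h4
      exact h4 (by simpa using hu)
    · rw [T_impE, T_notE, T_andE, T_andE, h3, T_notE, T_notE,
        T_coreAt h' hR hD (by simpa using hu'), inR, T_read, eval_var]
      simp only [T_ltE, eval_var, Function.update_self, hR u hu']
      intro h5
      exact h2 u (by simpa using h5)
  rw [candE, T_orE, T_coreAt h hR hD h16, h1, cand]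
  simp [h16]

end Semantics
end BFVD

namespace BFVD

/-! ### Branching on the candidates -/

open Classical in
theorem card_first_le (C : Finset ℕ) (k : ℕ) :
    {v ∈ C | {u ∈ C | u < v}.card ≤ k}.card ≤ k + 1 := by
  by_contra! h
  set C₀ := {v ∈ C | {u ∈ C | u < v}.card ≤ k} with hC₀
  have hne : C₀.Nonempty := Finset.card_pos.1 (by omega)
  have hm := C₀.max'_mem hne
  have h1 : C₀.erase (C₀.max' hne) ⊆ {u ∈ C | u < C₀.max' hne} := fun u hu =>
    Finset.mem_filter.2 ⟨(Finset.mem_filter.1 (Finset.mem_of_mem_erase hu)).1,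
      lt_of_le_of_ne (C₀.le_max' u (Finset.mem_of_mem_erase hu)) (Finset.ne_of_mem_erase hu)⟩
  have h2 := Finset.card_le_card h1
  rw [Finset.card_erase_of_mem hm] at h2
  have h3 := (Finset.mem_filter.1 hm).2
  omega

open Classical in
theorem lt_card_first {C : Finset ℕ} {k : ℕ} (h : k < C.card) :
    k < {v ∈ C | {u ∈ C | u < v}.card ≤ k}.card := by
  by_contra! h1
  set C₀ := {v ∈ C | {u ∈ C | u < v}.card ≤ k} with hC₀
  have hne : (C \ C₀).Nonempty := by
    rw [← Finset.card_pos]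
    have := Finset.le_card_sdiff C₀ C
    omega
  have hm := (C \ C₀).min'_mem hne
  have h2 : {u ∈ C | u < (C \ C₀).min' hne} ⊆ C₀ := by
    intro u hu
    obtain ⟨hu1, hu2⟩ := Finset.mem_filter.1 hu
    by_contra hc
    exact absurd ((C \ C₀).min'_le u (Finset.mem_sdiff.2 ⟨hu1, hc⟩)) (not_le.2 hu2)
  exact (Finset.mem_sdiff.1 hm).2 (Finset.mem_filter.2 ⟨(Finset.mem_sdiff.1 hm).1,
    (Finset.card_le_card h2).trans h1⟩)

/-- No vertex violates its condition: `R` meets all bicliques `K_{i,j}` with a side that lies in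
`D` up to at most one vertex. Sides that lie in `D` are covered by the vertices `a ∈ D`, as a side
is nonempty for positive `i` and `j`. -/
def Sol (H : SimpleGraph ℕ) (n i j : ℕ) (D R : Finset ℕ) : Prop :=
  ∀ a < n, ¬ Viol H n i j D R a

/-- `S` meets the cycle `a, b, c, d` of length four, if this is one. -/
def Meets (H : SimpleGraph ℕ) (a b c d : ℕ) (S : Finset ℕ) : Prop :=
  a ≠ c → b ≠ d → H.Adj a b → H.Adj b c → H.Adj c d → H.Adj d a →
    a ∈ S ∨ b ∈ S ∨ c ∈ S ∨ d ∈ S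

/-- The set `F` meets every cycle of length four. -/
def HitsC4 (H : SimpleGraph ℕ) (F : Finset ℕ) : Prop :=
  ∀ a b c d, Meets H a b c d F

variable {H : SimpleGraph ℕ} {n i j k : ℕ} {D R : Finset ℕ}

theorem mem_nbrs {S : Finset ℕ} {w : ℕ} :
    w ∈ nbrs H n S R ↔ w < n ∧ w ∉ R ∧ ∀ v ∈ S, H.Adj v w := by
  simp [nbrs]

theorem mem_core {v : ℕ} : v ∈ core H n i j k D R ↔ v < n ∧ (v ∈ D ∨ (v ∉ D ∧ Viol H n i j D R v) ∧
    by classical exact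
      {u ∈ Finset.range n | u < v ∧ u ∉ D ∧ Viol H n i j D R u}.card ≤ k) := by
  simp [core]

theorem mem_cand {v : ℕ} : v ∈ cand H n i j k D R ↔
    v < n ∧ (v ∈ core H n i j k D R ∨ Rep H (core H n i j k D R) R v) := by
  simp [cand]

theorem Side.anti {S R' : Finset ℕ} (h : R ⊆ R') (hS : Side H n i j S R') : Side H n i j S R := by
  have h1 : (nbrs H n S R').card ≤ (nbrs H n S R).card := Finset.card_le_card fun w hw => by
    rw [mem_nbrs] at hw ⊢
    exact ⟨hw.1, fun hc => hw.2.1 (h hc), hw.2.2⟩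
  exact ⟨hS.1.mono_right h, hS.2.imp (And.imp_right h1.trans') (And.imp_right h1.trans')⟩

theorem Viol.anti {R' : Finset ℕ} {a : ℕ} (h : R ⊆ R') (hv : Viol H n i j D R' a) :
    Viol H n i j D R a :=
  let ⟨S, hS, h1⟩ := hv
  ⟨S, hS, h1.anti h⟩

theorem Sol.mono {R' : Finset ℕ} (h : R ⊆ R') (hs : Sol H n i j D R) : Sol H n i j D R' :=
  fun a ha hv => hs a ha (hv.anti h)

open Classical in
/-- The violated vertices outside `D`. -/
noncomputable def cents (H : SimpleGraph ℕ) (n i j : ℕ) (D R : Finset ℕ) : Finset ℕ :=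
  {u ∈ Finset.range n | u ∉ D ∧ Viol H n i j D R u}

theorem mem_core_iff (hD : D ⊆ Finset.range n) {v : ℕ} : v ∈ core H n i j k D R ↔
    v ∈ D ∨ v ∈ cents H n i j D R ∧ {u ∈ cents H n i j D R | u < v}.card ≤ k := by
  classical
  have h1 : {u ∈ cents H n i j D R | u < v} =
      {u ∈ Finset.range n | u < v ∧ u ∉ D ∧ Viol H n i j D R u} := by
    ext u
    simp only [cents, Finset.mem_filter]
    tauto
  have h2 : v ∈ D → v < n := fun h => Finset.mem_range.1 (hD h)
  rw [mem_core, h1]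
  simp only [cents, Finset.mem_filter, Finset.mem_range]
  tauto

theorem card_core_le (hD : D ⊆ Finset.range n) : (core H n i j k D R).card ≤ D.card + (k + 1) := by
  classical
  have h1 : core H n i j k D R ⊆ D ∪
      {v ∈ cents H n i j D R | {u ∈ cents H n i j D R | u < v}.card ≤ k} := by
    intro v hv
    rw [mem_core_iff hD] at hv
    simpa using hv
  refine (Finset.card_le_card h1).trans ((Finset.card_union_le _ _).trans ?_)
  exact Nat.add_le_add_left (by convert card_first_le (cents H n i j D R) k) _

/-- There are at most `2 ^ |Z|` candidates outside the core `Z`, one for each neighbourhood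
in `Z`. -/
theorem card_cand_le (hD : D ⊆ Finset.range n) :
    (cand H n i j k D R).card ≤ 2 ^ (D.card + k + 2) := by
  classical
  set Z := core H n i j k D R with hZ
  have h1 : (cand H n i j k D R \ Z).card ≤ Z.powerset.card := by
    refine Finset.card_le_card_of_injOn (fun v => {z ∈ Z | H.Adj v z})
      (fun v _ => Finset.mem_coe.2 (Finset.mem_powerset.2 (Finset.filter_subset _ _))) ?_
    have hlt : ∀ u v, u ∈ cand H n i j k D R \ Z → v ∈ cand H n i j k D R \ Z →
        {z ∈ Z | H.Adj u z} = {z ∈ Z | H.Adj v z} → ¬ u < v := by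
      intro u v hu hv huv hlt
      obtain ⟨hu, huZ⟩ := Finset.mem_sdiff.1 hu
      obtain ⟨hv, hvZ⟩ := Finset.mem_sdiff.1 hv
      have hu' := (mem_cand.1 hu).2.resolve_left huZ
      have hv' := (mem_cand.1 hv).2.resolve_left hvZ
      refine hv'.2 u hlt ⟨hu'.1, huZ, fun z hz => ?_⟩
      have := Finset.ext_iff.1 huv z
      simpa [show z ∈ Z from hz] using this
    intro u hu v hv huv
    exact le_antisymm (not_lt.1 (hlt v u hv hu huv.symm)) (not_lt.1 (hlt u v hu hv huv))
  have h2 := Finset.card_le_card_sdiff_add_card (s := cand H n i j k D R) (t := Z)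
  rw [Finset.card_powerset] at h1
  have h3 : Z.card < 2 ^ Z.card := Nat.lt_two_pow_self
  have h4 : 2 ^ Z.card ≤ 2 ^ (D.card + (k + 1)) := Nat.pow_le_pow_right (by norm_num) (card_core_le hD)
  have h5 : 2 ^ (D.card + k + 2) = 2 * 2 ^ (D.card + (k + 1)) := by ring
  omega

/-- The branching step. If a solution `X` deletes at most `k` vertices in addition to `R`, and at
least one, then some candidate lies in a solution that is no larger. There are three cases. If `X`
contains a further vertex of the core, that vertex will do. If there are more than `k` violated
centres, two of the first `k + 1` of them are adjacent to the same vertex of `X`; as there are no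
cycles of length four outside `D`, no other vertex has the same neighbours in the core. Otherwise
all violated centres lie in the core, and a vertex of `X` may be exchanged for any other vertex with
the same neighbours in the core. -/
theorem exists_cand (hD : D ⊆ Finset.range n) (hC4 : HitsC4 H D) {X : Finset ℕ} (hRX : R ⊆ X)
    (hX : Sol H n i j D X) (hlt : ∀ x ∈ X \ R, x < n) (hne : (X \ R).Nonempty)
    (hk : (X \ R).card ≤ k) :
    ∃ x ∈ cand H n i j k D R, ∃ X', insert x R ⊆ X' ∧ Sol H n i j D X' ∧
      (∀ y ∈ X' \ insert x R, y < n) ∧ (X' \ insert x R).card < (X \ R).card := by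
  classical
  set Z := core H n i j k D R with hZ
  have hDZ : D ⊆ Z := fun v hv => (mem_core_iff hD).2 (Or.inl hv)
  -- It suffices to find a candidate in `X \ R`.
  have simple : ∀ x ∈ X \ R, x ∈ cand H n i j k D R →
      ∃ x ∈ cand H n i j k D R, ∃ X', insert x R ⊆ X' ∧ Sol H n i j D X' ∧
      (∀ y ∈ X' \ insert x R, y < n) ∧ (X' \ insert x R).card < (X \ R).card := by
    intro x hx hc
    have hsub : X \ insert x R ⊆ X \ R := Finset.sdiff_subset_sdiff le_rfl (Finset.subset_insert _ _)
    refine ⟨x, hc, X, Finset.insert_subset (Finset.mem_sdiff.1 hx).1 hRX, hX,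
      fun y hy => hlt y (hsub hy), Finset.card_lt_card ⟨hsub, fun h => ?_⟩⟩
    exact (Finset.mem_sdiff.1 (h hx)).2 (Finset.mem_insert_self _ _)
  by_cases h1 : ∃ x ∈ X \ R, x ∈ Z
  · obtain ⟨x, hx, hxZ⟩ := h1
    exact simple x hx (mem_cand.2 ⟨hlt x hx, Or.inl hxZ⟩)
  push Not at h1
  set C := cents H n i j D R with hC
  by_cases h2 : k < C.card
  · -- Each of the first `k + 1` centres has a neighbour in `X \ R`.
    have h3 := lt_card_first h2
    set C₀ := {v ∈ C | {u ∈ C | u < v}.card ≤ k} with hC₀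
    have hC₀Z : ∀ a ∈ C₀, a ∈ Z := fun a ha => by
      rw [hZ, mem_core_iff hD]
      refine Or.inr ⟨(Finset.mem_filter.1 ha).1, ?_⟩
      convert (Finset.mem_filter.1 ha).2
    have hCD : ∀ a ∈ C₀, a < n ∧ a ∉ D ∧ Viol H n i j D R a := fun a ha => by
      simpa [hC, cents] using (Finset.mem_filter.1 ha).1
    have h4 : ∀ a, ∃ x, a ∈ C₀ → x ∈ X \ R ∧ H.Adj a x := by
      intro a
      by_cases ha : a ∈ C₀
      · obtain ⟨han, haD, S, hS, hdisj, hside⟩ := hCD a ha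
        have hSZ : insert a S ⊆ Z := Finset.insert_subset (hC₀Z a ha) (hS.trans hDZ)
        by_contra! hc
        refine hX a han ⟨S, hS, Finset.disjoint_left.2 fun v hv hvX => ?_, ?_⟩
        · have hvR : v ∉ R := Finset.disjoint_left.1 hdisj hv
          exact h1 v (Finset.mem_sdiff.2 ⟨hvX, hvR⟩) (hSZ hv)
        · have h5 : nbrs H n (insert a S) R ⊆ nbrs H n (insert a S) X := by
            intro w hw
            rw [mem_nbrs] at hw ⊢
            refine ⟨hw.1, fun hwX => ?_, hw.2.2⟩
            exact (hc w).2 (Finset.mem_sdiff.2 ⟨hwX, hw.2.1⟩) (hw.2.2 a (Finset.mem_insert_self _ _))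
          have h6 := Finset.card_le_card h5
          exact hside.imp (And.imp_right h6.trans') (And.imp_right h6.trans')
      · exact ⟨0, fun h => absurd h ha⟩
    choose f hf using h4
    obtain ⟨a, ha, b, hb, hab, hfab⟩ := Finset.exists_ne_map_eq_of_card_lt_of_maps_to
      (lt_of_le_of_lt hk h3) (fun a ha => (hf a ha).1)
    refine simple (f a) (hf a ha).1 (mem_cand.2 ⟨hlt _ (hf a ha).1, Or.inr
      ⟨(Finset.mem_sdiff.1 (hf a ha).1).2, ?_⟩⟩)
    rintro u hu ⟨-, huZ, hu'⟩
    have hax := (hf a ha).2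
    have hbx : H.Adj b (f a) := hfab ▸ (hf b hb).2
    have := hC4 a (f a) b u hab hu.ne' hax hbx.symm ((hu' b (hC₀Z b hb)).2 hbx.symm).symm
      ((hu' a (hC₀Z a ha)).2 hax.symm)
    rcases this with h | h | h | h
    · exact (hCD a ha).2.1 h
    · exact h1 _ (hf a ha).1 (hDZ h)
    · exact (hCD b hb).2.1 h
    · exact huZ (hDZ h)
  · -- All violated centres lie in `Z`, and the first vertex equivalent to `u ∈ X \ R` replaces `u`.
    have hCZ : ∀ a < n, Viol H n i j D R a → a ∈ Z := by
      intro a ha hv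
      rw [hZ, mem_core_iff hD]
      by_cases haD : a ∈ D
      · exact Or.inl haD
      · refine Or.inr ⟨by simp [cents, ha, haD, hv], ?_⟩
        exact (Finset.card_le_card (Finset.filter_subset _ _)).trans (not_lt.1 h2)
    obtain ⟨u, hu⟩ := hne
    have huR := (Finset.mem_sdiff.1 hu).2
    have hex : ∃ v, v ∉ R ∧ v ∉ Z ∧ ∀ z ∈ Z, (H.Adj v z ↔ H.Adj u z) :=
      ⟨u, huR, h1 u hu, fun _ _ => Iff.rfl⟩
    obtain ⟨hvR, hvZ, hv⟩ := Nat.find_spec hex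
    have hvu : Nat.find hex ≤ u := Nat.find_min' hex ⟨huR, h1 u hu, fun _ _ => Iff.rfl⟩
    have hmin : ∀ w < Nat.find hex, _ := fun w hw => Nat.find_min hex hw
    set v := Nat.find hex
    have hvc : v ∈ cand H n i j k D R := mem_cand.2 ⟨hvu.trans_lt (hlt u hu), Or.inr ⟨hvR,
      fun w hw h => hmin w hw ⟨h.1, h.2.1, fun z hz => (h.2.2 z hz).trans (hv z hz)⟩⟩⟩
    by_cases hvX : v ∈ X
    · exact simple v (Finset.mem_sdiff.2 ⟨hvX, hvR⟩) hvc
    have huv : u ≠ v := fun h => hvX (h ▸ (Finset.mem_sdiff.1 hu).1)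
    have hRX' : R ⊆ insert v (X.erase u) := fun w hw => Finset.mem_insert_of_mem
      (Finset.mem_erase.2 ⟨fun h => huR (h ▸ hw), hRX hw⟩)
    have hsub : insert v (X.erase u) \ insert v R ⊆ (X \ R).erase u := by
      intro w hw
      simp only [Finset.mem_sdiff, Finset.mem_insert, Finset.mem_erase, not_or] at hw ⊢
      tauto
    refine ⟨v, hvc, insert v (X.erase u), Finset.insert_subset (Finset.mem_insert_self _ _) hRX',
      ?_, fun y hy => hlt y (Finset.mem_of_mem_erase (hsub hy)),
      (Finset.card_le_card hsub).trans_lt (Finset.card_erase_lt_of_mem hu)⟩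
    intro a ha hviol
    have haZ := hCZ a ha (hviol.anti hRX')
    obtain ⟨S, hS, hdisj, hside⟩ := hviol
    have hSZ : insert a S ⊆ Z := Finset.insert_subset haZ (hS.trans hDZ)
    refine hX a ha ⟨S, hS, Finset.disjoint_left.2 fun w hw hwX => ?_, ?_⟩
    · refine Finset.disjoint_left.1 hdisj hw (Finset.mem_insert_of_mem
        (Finset.mem_erase.2 ⟨fun h => h1 u hu (h ▸ hSZ hw), hwX⟩))
    · have h5 : (nbrs H n (insert a S) (insert v (X.erase u))).card ≤
          (nbrs H n (insert a S) X).card := by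
        refine Finset.card_le_card_of_injOn (Equiv.swap u v) ?_ (Equiv.injective _).injOn
        intro w hw
        rw [Finset.mem_coe, mem_nbrs] at hw ⊢
        obtain ⟨hwn, hwX, hadj⟩ := hw
        simp only [Finset.mem_insert, Finset.mem_erase, not_or, not_and] at hwX
        by_cases hwu : w = u
        · subst hwu
          rw [Equiv.swap_apply_left]
          exact ⟨hvu.trans_lt hwn, hvX, fun z hz => ((hv z (hSZ hz)).2 (hadj z hz).symm).symm⟩
        · rw [Equiv.swap_apply_of_ne_of_ne hwu hwX.1]
          exact ⟨hwn, hwX.2 hwu, hadj⟩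
      exact hside.imp (And.imp_right h5.trans') (And.imp_right h5.trans')

end BFVD

namespace BFVD

/-! ### Bicliques and solutions -/

variable {n i j k : ℕ} {D R : Finset ℕ}

theorem exists_viol_of_side {H : SimpleGraph ℕ} {L : Finset ℕ} (hL : L.Nonempty)
    (hLn : L ⊆ Finset.range n) (h1 : (L \ D).card ≤ 1) (hs : Side H n i j L R) :
    ∃ a < n, Viol H n i j D R a := by
  rcases Nat.le_one_iff_eq_zero_or_eq_one.1 h1 with h0 | h1
  · obtain ⟨a, ha⟩ := hL
    refine ⟨a, Finset.mem_range.1 (hLn ha), L, ?_, by rwa [Finset.insert_eq_of_mem ha]⟩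
    rwa [Finset.card_eq_zero, Finset.sdiff_eq_empty_iff_subset] at h0
  · obtain ⟨a, ha⟩ := Finset.card_eq_one.1 h1
    have ha' : a ∈ L := (Finset.mem_sdiff.1 (ha ▸ Finset.mem_singleton_self a)).1
    refine ⟨a, Finset.mem_range.1 (hLn ha'), L ∩ D, Finset.inter_subset_right, ?_⟩
    convert hs using 1
    rw [Finset.insert_eq, ← ha, Finset.sdiff_union_inter]

/-- Every biclique that avoids a solution has a side with at most one vertex outside `D`, since
`D` meets all cycles of length four. -/
theorem Sol.no_biclique {H : SimpleGraph ℕ} (hsol : Sol H n i j D R) (hC4 : HitsC4 H D)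
    {L M : Finset ℕ} (hi : 0 < i) (hj : 0 < j) (hL : L.card = i) (hM : M.card = j)
    (hLn : L ⊆ Finset.range n) (hMn : M ⊆ Finset.range n) (hLR : Disjoint L R) (hMR : Disjoint M R)
    (h : ∀ u ∈ L, ∀ v ∈ M, H.Adj u v) : False := by
  have hMN : M ⊆ nbrs H n L R := fun w hw => mem_nbrs.2 ⟨Finset.mem_range.1 (hMn hw),
    Finset.disjoint_left.1 hMR hw, fun v hv => h v hv w hw⟩
  have hLN : L ⊆ nbrs H n M R := fun w hw => mem_nbrs.2 ⟨Finset.mem_range.1 (hLn hw),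
    Finset.disjoint_left.1 hLR hw, fun v hv => (h w hw v hv).symm⟩
  by_cases hL1 : (L \ D).card ≤ 1
  · obtain ⟨a, ha, hv⟩ := exists_viol_of_side (i := i) (j := j) (Finset.card_pos.1 (hL ▸ hi)) hLn hL1
      ⟨hLR, Or.inl ⟨hL.ge, hM ▸ Finset.card_le_card hMN⟩⟩
    exact hsol a ha hv
  by_cases hM1 : (M \ D).card ≤ 1
  · obtain ⟨a, ha, hv⟩ := exists_viol_of_side (i := i) (j := j) (Finset.card_pos.1 (hM ▸ hj)) hMn hM1
      ⟨hMR, Or.inr ⟨hM.ge, hL ▸ Finset.card_le_card hLN⟩⟩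
    exact hsol a ha hv
  obtain ⟨a, ha, c, hc, hac⟩ := Finset.one_lt_card.1 (not_le.1 hL1)
  obtain ⟨b, hb, d, hd, hbd⟩ := Finset.one_lt_card.1 (not_le.1 hM1)
  rw [Finset.mem_sdiff] at ha hb hc hd
  have := hC4 a b c d hac hbd (h a ha.1 b hb.1) (h c hc.1 b hb.1).symm (h c hc.1 d hd.1)
    (h a ha.1 d hd.1).symm
  tauto

/-- The graph on the natural numbers with the edges of `G`. -/
def natGraph (G : SimpleGraph (Fin n)) : SimpleGraph ℕ := G.map Fin.valEmbedding

theorem natGraph_adj {G : SimpleGraph (Fin n)} {u v : ℕ} :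
    (natGraph G).Adj u v ↔ ∃ u' v' : Fin n, G.Adj u' v' ∧ (u' : ℕ) = u ∧ (v' : ℕ) = v := by
  exact SimpleGraph.map_adj _ _ _ _

theorem natGraph_adj_val {G : SimpleGraph (Fin n)} {u v : Fin n} :
    (natGraph G).Adj u v ↔ G.Adj u v := by
  refine natGraph_adj.trans ⟨?_, fun h => ⟨u, v, h, rfl, rfl⟩⟩
  rintro ⟨u', v', h, hu, hv⟩
  rwa [Fin.val_injective hu, Fin.val_injective hv] at h

theorem isYes_of_sol {G : SimpleGraph (Fin n)} (hC4 : HitsC4 (natGraph G) D) (hi : 0 < i)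
    (hj : 0 < j) (hR : R.card ≤ k) (hsol : Sol (natGraph G) n i j D R) : IsYes G i j k := by
  classical
  refine ⟨Finset.univ.filter fun v => (v : ℕ) ∈ R, ?_, fun hcon => ?_⟩
  · refine le_trans ?_ hR
    refine Finset.card_le_card_of_injOn Fin.val (fun v hv => ?_) Fin.val_injective.injOn
    simpa using hv
  rw [SimpleGraph.completeBipartiteGraph_isContained_iff] at hcon
  obtain ⟨L, M, hL, hM, h⟩ := hcon
  simp only [Fintype.card_fin] at hL hM
  let f := (Function.Embedding.subtype
    (· ∈ ((Finset.univ.filter fun v : Fin n => (v : ℕ) ∈ R : Finset (Fin n)) : Set (Fin n))ᶜ)).trans Fin.valEmbedding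
  have hdisj : ∀ L : Finset _, Disjoint (L.map f) R := by
    intro L
    rw [Finset.disjoint_left]
    intro v hv
    obtain ⟨w, -, rfl⟩ := Finset.mem_map.1 hv
    have hw : (w.1 : ℕ) ∉ R := by simpa using w.2
    exact hw
  have hrange : ∀ L : Finset _, L.map f ⊆ Finset.range n := by
    intro L v hv
    obtain ⟨w, -, rfl⟩ := Finset.mem_map.1 hv
    exact Finset.mem_range.2 w.1.2
  refine hsol.no_biclique hC4 hi hj (L := L.map f) (M := M.map f) (by simpa) (by simpa) (hrange L)
    (hrange M) (hdisj L) (hdisj M) ?_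
  intro u hu v hv
  obtain ⟨u, hu', rfl⟩ := Finset.mem_map.1 hu
  obtain ⟨v, hv', rfl⟩ := Finset.mem_map.1 hv
  exact natGraph_adj_val.2 (h hu' hv')

theorem exists_sol_of_isYes {G : SimpleGraph (Fin n)} (hD : D ⊆ Finset.range n)
    (h : IsYes G i j k) : ∃ X ⊆ Finset.range n, X.card ≤ k ∧ Sol (natGraph G) n i j D X := by
  classical
  obtain ⟨X, hX, hfree⟩ := h
  refine ⟨X.map Fin.valEmbedding, fun v hv => ?_, by simpa, ?_⟩
  · obtain ⟨w, -, rfl⟩ := Finset.mem_map.1 hv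
    exact Finset.mem_range.2 w.2
  rintro a ha ⟨S, hS, hdisj, hside⟩
  set L := insert a S
  set M := nbrs (natGraph G) n L (X.map Fin.valEmbedding)
  have hLn : ∀ v ∈ L, v < n ∧ v ∉ X.map Fin.valEmbedding := fun v hv =>
    ⟨by
      rcases Finset.mem_insert.1 hv with rfl | hv
      · exact ha
      · exact Finset.mem_range.1 (hD (hS hv)), Finset.disjoint_left.1 hdisj hv⟩
  have hMn : ∀ v ∈ M, v < n ∧ v ∉ X.map Fin.valEmbedding := fun v hv =>
    ⟨(mem_nbrs.1 hv).1, (mem_nbrs.1 hv).2.1⟩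
  have hLM : ∀ u ∈ L, ∀ v ∈ M, (natGraph G).Adj u v := fun u hu v hv => (mem_nbrs.1 hv).2.2 u hu
  let f := (Function.Embedding.subtype (· ∈ ((X : Set (Fin n)))ᶜ)).trans Fin.valEmbedding
  have hpre : ∀ P : Finset ℕ, (∀ v ∈ P, v < n ∧ v ∉ X.map Fin.valEmbedding) →
      ∃ Q : Finset ↑((X : Set (Fin n)))ᶜ, Q.map f = P := by
    intro P hP
    refine ⟨Finset.univ.filter fun v => f v ∈ P, ?_⟩
    ext v
    simp only [Finset.mem_map, Finset.mem_filter, Finset.mem_univ, true_and]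
    constructor
    · rintro ⟨w, hw, rfl⟩
      exact hw
    · intro hv
      obtain ⟨hvn, hvX⟩ := hP v hv
      have hvX' : (⟨v, hvn⟩ : Fin n) ∈ (X : Set (Fin n))ᶜ := fun h =>
        hvX (Finset.mem_map.2 ⟨_, h, rfl⟩)
      exact ⟨⟨⟨v, hvn⟩, hvX'⟩, hv, rfl⟩
  have main : ∀ L M : Finset ℕ, (∀ v ∈ L, v < n ∧ v ∉ X.map Fin.valEmbedding) →
      (∀ v ∈ M, v < n ∧ v ∉ X.map Fin.valEmbedding) → (∀ u ∈ L, ∀ v ∈ M, (natGraph G).Adj u v) →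
      i ≤ L.card → j ≤ M.card → False := by
    intro L M hLn hMn hLM hL hM
    obtain ⟨L', hL', hLi⟩ := Finset.exists_subset_card_eq hL
    obtain ⟨M', hM', hMj⟩ := Finset.exists_subset_card_eq hM
    obtain ⟨P, rfl⟩ := hpre L' fun v hv => hLn v (hL' hv)
    obtain ⟨Q, rfl⟩ := hpre M' fun v hv => hMn v (hM' hv)
    apply hfree
    rw [SimpleGraph.completeBipartiteGraph_isContained_iff]
    refine ⟨P, Q, by simpa using hLi, by simpa using hMj, fun u hu v hv => ?_⟩
    exact natGraph_adj_val.1 (hLM _ (hL' (Finset.mem_map_of_mem f hu)) _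
      (hM' (Finset.mem_map_of_mem f hv)))
  rcases hside with ⟨h1, h2⟩ | ⟨h1, h2⟩
  · exact main L M hLn hMn hLM h1 h2
  · exact main M L hMn hLn (fun u hu v hv => (hLM v hv u hu).symm) h2 h1

/-- A feedback vertex set meets all cycles of length four. -/
theorem exists_hitsC4 (G : SimpleGraph (Fin n)) :
    ∃ F : Finset ℕ, F.card = fvn G ∧ HitsC4 (natGraph G) F := by
  classical
  obtain ⟨D, hD, hcard⟩ : fvn G ∈ {d | ∃ D : Finset (Fin n), IsFeedbackVertexSet G D ∧ D.card = d} :=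
    Nat.sInf_mem ⟨_, Finset.univ, fun v => by simpa using v.2, rfl⟩
  refine ⟨D.map Fin.valEmbedding, by simpa using hcard, ?_⟩
  intro a b c d hac hbd hab hbc hcd hda
  by_contra! hc
  obtain ⟨ha, hb, hc, hd⟩ := hc
  have hlift : ∀ u, u ∉ D.map Fin.valEmbedding → (∃ v, (natGraph G).Adj u v) →
      ∃ w : ↑((D : Set (Fin n)))ᶜ, (w.1 : ℕ) = u := by
    rintro u hu ⟨v, huv⟩
    obtain ⟨u, v, -, rfl, rfl⟩ := natGraph_adj.1 huv
    exact ⟨⟨u, fun h => hu (Finset.mem_map.2 ⟨u, h, rfl⟩)⟩, rfl⟩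
  obtain ⟨a, rfl⟩ := hlift a ha ⟨_, hab⟩
  obtain ⟨b, rfl⟩ := hlift b hb ⟨_, hbc⟩
  obtain ⟨c, rfl⟩ := hlift c hc ⟨_, hcd⟩
  obtain ⟨d, rfl⟩ := hlift d hd ⟨_, hda⟩
  rw [natGraph_adj_val] at hab hbc hcd hda
  have hac' : a ≠ c := fun h => hac (by rw [h])
  let G' := G.induce ((D : Set (Fin n)))ᶜ
  have hab' : G'.Adj a b := hab
  have hbc' : G'.Adj b c := hbc
  have hcd' : G'.Adj c d := hcd
  have hda' : G'.Adj d a := hda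
  -- Two paths of length two from `a` to `c`.
  have h1 := (hD.subsingleton_path a c).elim (⟨.cons hab' (.cons hbc' .nil), by
    simp [hab'.ne, hac', hbc'.ne]⟩ : G'.Path a c) ⟨.cons hda'.symm (.cons hcd'.symm .nil), by
    simp [hda'.ne.symm, hac', hcd'.ne.symm]⟩
  simp at h1
  exact hbd (by rw [h1.1])

/-! ### Guessing the sequence of candidates -/

/-- The element of `C` with exactly `r` smaller elements in `C`, as the number of all `v < n` with at
most `r` elements of `C` up to `v`. It is `n` if `C` has at most `r` elements. -/
def pick (n : ℕ) (C : Finset ℕ) (r : ℕ) : ℕ :=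
  {v ∈ Finset.range n | {u ∈ C | u ≤ v}.card ≤ r}.card

theorem exists_pick {C : Finset ℕ} (hC : C ⊆ Finset.range n) {x : ℕ} (hx : x ∈ C) :
    ∃ r < C.card, pick n C r = x := by
  have hlt : {u ∈ C | u < x}.card < C.card :=
    Finset.card_lt_card (Finset.filter_ssubset.2 ⟨x, hx, lt_irrefl x⟩)
  refine ⟨_, hlt, ?_⟩
  have h1 : {v ∈ Finset.range n | {u ∈ C | u ≤ v}.card ≤ {u ∈ C | u < x}.card} =
      Finset.range x := by
    ext v
    have hxn := Finset.mem_range.1 (hC hx)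
    simp only [Finset.mem_filter, Finset.mem_range]
    constructor
    · rintro ⟨-, h⟩
      by_contra! hxv
      have h2 : insert x {u ∈ C | u < x} ⊆ {u ∈ C | u ≤ v} := by
        intro u hu
        rcases Finset.mem_insert.1 hu with rfl | hu
        · exact Finset.mem_filter.2 ⟨hx, hxv⟩
        · have := Finset.mem_filter.1 hu
          exact Finset.mem_filter.2 ⟨this.1, by omega⟩
      have h3 := Finset.card_le_card h2
      rw [Finset.card_insert_of_notMem (by simp)] at h3
      omega
    · intro hv
      refine ⟨by omega, Finset.card_le_card fun u hu => ?_⟩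
      have := Finset.mem_filter.1 hu
      exact Finset.mem_filter.2 ⟨this.1, by omega⟩
  rw [pick, h1, Finset.card_range]

/-- One branching step: the set of deleted vertices and the remaining digits of the guess. -/
noncomputable def branch (H : SimpleGraph ℕ) (n i j k : ℕ) (D : Finset ℕ) (s : Finset ℕ × ℕ) :
    Finset ℕ × ℕ :=
  (insert (pick n (cand H n i j k D s.1) (s.2 % 2 ^ (D.card + k + 2))) s.1,
    s.2 / 2 ^ (D.card + k + 2))

theorem card_branch_le {H : SimpleGraph ℕ} (s : Finset ℕ × ℕ) (t : ℕ) :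
    ((branch H n i j k D)^[t] s).1.card ≤ s.1.card + t := by
  induction t with
  | zero => simp
  | succ t ih =>
    rw [Function.iterate_succ_apply']
    exact (Finset.card_insert_le _ _).trans (by omega)

theorem subset_branch {H : SimpleGraph ℕ} (s : Finset ℕ × ℕ) (t : ℕ) :
    s.1 ⊆ ((branch H n i j k D)^[t] s).1 := by
  induction t with
  | zero => simp
  | succ t ih =>
    rw [Function.iterate_succ_apply']
    exact ih.trans (Finset.subset_insert _ _)

/-- Some guess leads to a solution, if there is one that deletes at most `t` more vertices. -/
theorem exists_guess {H : SimpleGraph ℕ} (hD : D ⊆ Finset.range n) (hC4 : HitsC4 H D) {t : ℕ}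
    (ht : t ≤ k) : ∀ {R X : Finset ℕ}, R ⊆ X → Sol H n i j D X → (∀ x ∈ X \ R, x < n) →
      (X \ R).card ≤ t → ∃ g < (2 ^ (D.card + k + 2)) ^ t,
        Sol H n i j D ((branch H n i j k D)^[t] (R, g)).1 := by
  induction t with
  | zero =>
    intro R X _ hX _ hc
    refine ⟨0, by simp, hX.mono ?_⟩
    simpa [Finset.sdiff_eq_empty_iff_subset] using hc
  | succ t ih =>
    intro R X hRX hX hlt hc
    rcases (X \ R).eq_empty_or_nonempty with he | hne
    · refine ⟨0, by positivity, hX.mono ?_⟩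
      exact (Finset.sdiff_eq_empty_iff_subset.1 he).trans (subset_branch (R, 0) _)
    obtain ⟨x, hx, X', h1, h2, h3, h4⟩ := exists_cand hD hC4 hRX hX hlt hne (hc.trans ht)
    obtain ⟨r, hr, hrx⟩ := exists_pick (fun v hv => Finset.mem_range.2 (mem_cand.1 hv).1) hx
    obtain ⟨g, hg, hsol⟩ := ih (by omega) h1 h2 h3 (by omega)
    have hr' := hr.trans_le (card_cand_le hD)
    set M := 2 ^ (D.card + k + 2) with hM
    have hM0 : 0 < M := by positivity
    refine ⟨g * M + r, ?_, ?_⟩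
    · calc g * M + r < (g + 1) * M := by linarith
        _ ≤ M ^ t * M := Nat.mul_le_mul_right _ hg
        _ = M ^ (t + 1) := (pow_succ _ _).symm
    · have h5 : branch H n i j k D (R, g * M + r) = (insert x R, g) := by
        simp only [branch, ← hM]
        rw [mul_comm, Nat.mul_add_mod, Nat.mod_eq_of_lt hr', hrx, Nat.mul_add_div hM0, Nat.div_eq_of_lt hr',
          add_zero]
      rwa [Function.iterate_succ_apply, h5]

/-- The instance is a yes-instance if and only if some guess leads to a solution. -/
theorem isYes_iff {G : SimpleGraph (Fin n)} (hD : D ⊆ Finset.range n) (hC4 : HitsC4 (natGraph G) D)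
    (hi : 0 < i) (hj : 0 < j) : IsYes G i j k ↔ ∃ g < (2 ^ (D.card + k + 2)) ^ k,
      Sol (natGraph G) n i j D ((branch (natGraph G) n i j k D)^[k] (∅, g)).1 := by
  constructor
  · intro h
    obtain ⟨X, hXn, hXk, hX⟩ := exists_sol_of_isYes hD h
    exact exists_guess hD hC4 le_rfl (Finset.empty_subset X) hX
      (fun x hx => Finset.mem_range.1 (hXn (Finset.mem_sdiff.1 hx).1)) (by simpa using hXk)
  · rintro ⟨g, -, h⟩
    exact isYes_of_sol hC4 hi hj ((card_branch_le _ _).trans (by simp)) h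

end BFVD

namespace BFVD
open Ex

/-! ### The search for a solution -/

section Search
variable {H : SimpleGraph ℕ} {n i j k : ℕ} {D R : Finset ℕ} {ρ : ℕ → ℕ} {A B : ℕ → ℕ → ℕ}

theorem Encodes.congr (h : Encodes H n i j k D ρ A) (hB : ∀ a, a ∉ [3, 5, 8] → B a = A a) :
    Encodes H n i j k D ρ B := by
  obtain ⟨h0, h1, h2, h3, h4, h5, h6, h7⟩ := h
  constructor <;> first | assumption | (rw [hB _ (by decide)]; assumption)

theorem eval_quotE (hM : 0 < ρ 5) (hg : A 5 0 ≤ ρ 6) : quotE.eval A ρ = A 5 0 / ρ 5 := by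
  classical
  have : {h ∈ Finset.range (ρ 6) | T A (leE (.add (.sum 19 18 (.var 5)) (.var 5))
      (.read 5 (.const 0))) (Function.update ρ 18 h)} = Finset.range (A 5 0 / ρ 5) := by
    ext h
    have h1 : h < A 5 0 / ρ 5 ↔ h * ρ 5 + ρ 5 ≤ A 5 0 := by
      rw [Nat.lt_iff_add_one_le, Nat.le_div_iff_mul_le hM, Nat.succ_mul]
    have h2 : h ≤ h * ρ 5 := Nat.le_mul_of_pos_right _ hM
    simp [h1]
    omega
  rw [quotE, eval_cntE, this, Finset.card_range]

theorem eval_choiceE (h : Encodes H n i j k D ρ A) (hR : EncodesR n R A) (hD : D ⊆ Finset.range n)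
    (hM : 0 < ρ 5) (hg : A 5 0 ≤ ρ 6) :
    choiceE.eval A ρ = pick n (cand H n i j k D R) (A 5 0 % ρ 5) := by
  classical
  rw [choiceE, eval_cntE, pick, h.var_n]
  congr 1
  refine Finset.filter_congr fun v hv => ?_
  have h' := h.update (x := 17) (by norm_num) v
  have h1 : (cntE 16 0 (andE (leE (.var 16) (.var 17)) candE)).eval A (Function.update ρ 17 v) =
      {u ∈ cand H n i j k D R | u ≤ v}.card := by
    rw [eval_cntE, h'.var_n]
    congr 1
    ext u
    simp only [Finset.mem_filter, Finset.mem_range]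
    by_cases hu : u < n
    · rw [T_andE, T_candE (h'.update (by norm_num) u) hR hD (by simpa using hu)]
      simp [hu, and_comm]
    · exact iff_of_false (fun hc => hu hc.1) (fun hc => hu (mem_cand.1 hc.1).1)
  have h2 : digitE.eval A (Function.update ρ 17 v) = A 5 0 % ρ 5 := by
    have h3 : ∀ w, quotE.eval A (Function.update (Function.update ρ 17 v) 20 w) = A 5 0 / ρ 5 := by
      intro w
      rw [eval_quotE] <;> simp [hM, hg]
    simp [digitE, h3, Nat.mod_eq_sub]
  rw [T_leE, h1, h2]

/-- One branching step. -/
def branchSt : St := .seq (.write 3 choiceE (.const 1)) (.write 5 (.const 0) quotE)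

/-- Restore all vertices. -/
def clearSt : St := .forDo 22 0 (.write 3 (.var 22) (.const 0))

/-- Follow the guess `21`, and record whether it leads to a solution. -/
def guessSt : St := .seq clearSt (.seq (.write 5 (.const 0) (.var 21))
  (.seq (.forDo 23 3 branchSt) (.write 8 (.const 0) (orE (.read 8 (.const 0)) solE))))

/-- Try all guesses. -/
def searchSt : St := .forDo 21 6 guessSt

theorem iter_induction {α : Type*} {f : ℕ → α → α} {a : α} (P : ℕ → α → Prop) (h0 : P 0 a) {m : ℕ}
    (hs : ∀ v < m, ∀ x, P v x → P (v + 1) (f v x)) : P m (iter f a m) := by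
  induction m with
  | zero => exact h0
  | succ m ih => exact hs m (by omega) _ (ih fun v hv => hs v (by omega))

theorem run_clearSt (hn : ρ 0 = n) : EncodesR n ∅ (clearSt.run ρ A) ∧
    ∀ a ≠ 3, clearSt.run ρ A a = A a := by
  have := iter_induction (f := fun v => (St.write 3 (.var 22) (.const 0)).run
      (Function.update ρ 22 v)) (a := A) (m := ρ 0)
    (fun t B => (∀ v < t, B 3 v = 0) ∧ ∀ a ≠ 3, B a = A a) (by simp)
    (fun t _ B hB => ⟨fun v hv => by
      by_cases hvt : v = t
      · simp [St.run, hvt]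
      · simp [St.run, hvt, hB.1 v (by omega)],
      fun a ha => by simp [St.run, ha, hB.2 a ha]⟩)
  rw [hn] at this
  refine ⟨fun v hv => ?_, ?_⟩
  · simpa [clearSt, St.run, hn] using this.1 v hv
  · simpa only [clearSt, St.run, hn] using this.2

theorem run_branchSt (h : Encodes H n i j k D ρ A) (hR : EncodesR n R A)
    (hD : D ⊆ Finset.range n) (hM : ρ 5 = 2 ^ (D.card + k + 2)) (hg : A 5 0 ≤ ρ 6) :
    EncodesR n (branch H n i j k D (R, A 5 0)).1 (branchSt.run ρ A) ∧
      branchSt.run ρ A 5 0 = (branch H n i j k D (R, A 5 0)).2 ∧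
      ∀ a, a ∉ [3, 5] → branchSt.run ρ A a = A a := by
  have hM0 : 0 < ρ 5 := by rw [hM]; positivity
  have h1 := eval_choiceE h hR hD hM0 hg
  refine ⟨fun v hv => ?_, ?_, fun a ha => ?_⟩
  · simp only [branchSt, St.run, h1, branch, ← hM, Finset.mem_insert, ← hR v hv]
    rw [Function.update_of_ne (by norm_num), Function.update_self, Function.update_apply]
    by_cases hvx : v = pick n (cand H n i j k D R) (A 5 0 % ρ 5) <;> simp [hvx]
  · simp only [branchSt, St.run, branch, ← hM]
    rw [eval_quotE hM0 (by simpa using hg)]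
    simp
  · simp only [List.mem_cons, List.not_mem_nil, or_false, not_or] at ha
    simp [branchSt, St.run, ha.1, ha.2]

theorem branch_snd_le (s : Finset ℕ × ℕ) (t : ℕ) : ((branch H n i j k D)^[t] s).2 ≤ s.2 := by
  induction t with
  | zero => simp
  | succ t ih =>
    rw [Function.iterate_succ_apply']
    exact (Nat.div_le_self _ _).trans ih

theorem run_guessSt (h : Encodes H n i j k D ρ A) (hD : D ⊆ Finset.range n)
    (hM : ρ 5 = 2 ^ (D.card + k + 2)) (hg : ρ 21 ≤ ρ 6) :
    (guessSt.run ρ A 8 0 ≠ 0 ↔ A 8 0 ≠ 0 ∨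
      Sol H n i j D ((branch H n i j k D)^[k] (∅, ρ 21)).1) ∧
      ∀ a, a ∉ [3, 5, 8] → guessSt.run ρ A a = A a := by
  obtain ⟨h1, h2⟩ := run_clearSt (A := A) h.var_n
  set A₁ := clearSt.run ρ A
  set A₂ := (St.write 5 (.const 0) (.var 21)).run ρ A₁ with hA₂
  have h3 : A₂ 5 0 = ρ 21 := by simp [hA₂, St.run]
  have h4 : ∀ a, a ≠ 5 → A₂ a = A₁ a := fun a ha => by simp [hA₂, St.run, ha]
  have h5 := iter_induction (f := fun v => branchSt.run (Function.update ρ 23 v)) (a := A₂) (m := ρ 3)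
    (fun t B => EncodesR n ((branch H n i j k D)^[t] (∅, ρ 21)).1 B ∧
      B 5 0 = ((branch H n i j k D)^[t] (∅, ρ 21)).2 ∧ ∀ a, a ∉ [3, 5] → B a = A a)
    ⟨fun v hv => by rw [h4 3 (by norm_num)]; exact h1 v hv, h3, fun a ha => by
      simp only [List.mem_cons, List.not_mem_nil, or_false, not_or] at ha
      rw [h4 a ha.2, h2 a ha.1]⟩
    (fun t _ B hB => by
      obtain ⟨hB1, hB2, hB3⟩ := hB
      have hE : Encodes H n i j k D (Function.update ρ 23 t) B :=
        (h.update (by norm_num) t).congr fun a ha => hB3 a (by simp at ha ⊢; tauto)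
      obtain ⟨h6, h7, h8⟩ := run_branchSt hE hB1 hD (by simpa using hM)
        (by simpa [hB2] using (branch_snd_le (∅, ρ 21) t).trans hg)
      rw [Function.iterate_succ_apply', ← Prod.mk.eta (p := (branch H n i j k D)^[t] (∅, ρ 21)),
        ← hB2]
      exact ⟨h6, h7, fun a ha => (h8 a ha).trans (hB3 a ha)⟩)
  rw [h.var_k] at h5
  obtain ⟨h6, -, h7⟩ := h5
  set A₃ := iter (fun v => branchSt.run (Function.update ρ 23 v)) A₂ k with hA₃
  have hrun : guessSt.run ρ A = (St.write 8 (.const 0) (orE (.read 8 (.const 0)) solE)).run ρ A₃ := by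
    simp only [guessSt, St.run, hA₃, hA₂, h.var_k]
    rfl
  have hE : Encodes H n i j k D ρ A₃ := h.congr fun a ha => h7 a (by simp at ha ⊢; tauto)
  rw [hrun]
  constructor
  · have h8 : (St.write 8 (.const 0) (orE (.read 8 (.const 0)) solE)).run ρ A₃ 8 0 =
        (orE (.read 8 (.const 0)) solE).eval A₃ ρ := by simp [St.run]
    rw [h8]
    change T A₃ _ ρ ↔ _
    rw [T_orE, T_solE hE h6 hD, T_read, h7 8 (by decide)]
    rfl
  · intro a ha
    have ha' : a ≠ 8 := by rintro rfl; simp at ha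
    simp only [St.run, Function.update_of_ne ha']
    exact h7 a (by simp at ha ⊢; tauto)

/-- The search finds out whether some guess leads to a solution. -/
theorem run_searchSt (h : Encodes H n i j k D ρ A) (hD : D ⊆ Finset.range n)
    (hM : ρ 5 = 2 ^ (D.card + k + 2)) (h8 : A 8 0 = 0) :
    searchSt.run ρ A 8 0 ≠ 0 ↔
      ∃ g < ρ 6, Sol H n i j D ((branch H n i j k D)^[k] (∅, g)).1 := by
  have := iter_induction (f := fun v => guessSt.run (Function.update ρ 21 v)) (a := A) (m := ρ 6)
    (fun t B => (B 8 0 ≠ 0 ↔ ∃ g < t, Sol H n i j D ((branch H n i j k D)^[k] (∅, g)).1) ∧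
      ∀ a, a ∉ [3, 5, 8] → B a = A a) (by simp [h8])
    (fun t ht B hB => by
      obtain ⟨h1, h2⟩ := run_guessSt (ρ := Function.update ρ 21 t) (A := B)
        ((h.update (by norm_num) t).congr hB.2) hD (by simpa using hM) (by simpa using ht.le)
      refine ⟨?_, fun a ha => (h2 a ha).trans (hB.2 a ha)⟩
      rw [h1, hB.1, Function.update_self]
      constructor
      · rintro (⟨g, hg, hs⟩ | hs)
        · exact ⟨g, by omega, hs⟩
        · exact ⟨t, by omega, hs⟩
      · rintro ⟨g, hg, hs⟩
        rcases Nat.lt_succ_iff_lt_or_eq.1 hg with hg | rfl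
        · exact Or.inl ⟨g, hg, hs⟩
        · exact Or.inr hs)
  exact this.1

end Search

/-! ### Packing cycles of length four -/

/-- The variables `10`, …, `13` form a cycle of length four outside `D`. -/
def c4E : Ex := andE (andE (andE (notE (inD 10)) (notE (inD 11)))
    (andE (notE (inD 12)) (notE (inD 13))))
  (andE (andE (notE (eqE (.var 10) (.var 12))) (notE (eqE (.var 11) (.var 13))))
    (andE (andE (adjE 10 11) (adjE 11 12)) (andE (adjE 12 13) (adjE 13 10))))

/-- Add the vertex `x` to `D`. -/
def addD (x : ℕ) : St := .write 2 (.var x) (.const 1)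

/-- Add the vertices `10`, …, `13` to `D` if they form a cycle of length four outside `D`. -/
def packStep : St :=
  .ite c4E (.seq (addD 10) (.seq (addD 11) (.seq (addD 12) (addD 13)))) .skip

/-- Collect a maximal family of disjoint cycles of length four. -/
def packSt : St := .forDo 10 0 (.forDo 11 0 (.forDo 12 0 (.forDo 13 0 packStep)))

section Pack
variable {H : SimpleGraph ℕ} {n : ℕ} {ρ : ℕ → ℕ} {A₀ A : ℕ → ℕ → ℕ}

/-- The set with the characteristic function in array `2`. -/
def dset (n : ℕ) (A : ℕ → ℕ → ℕ) : Finset ℕ := {v ∈ Finset.range n | A 2 v ≠ 0}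

/-- The invariant of the packing: apart from array `2` nothing has changed, and each set that meets
all cycles of length four contains at least a quarter of `D`. -/
def PackInv (H : SimpleGraph ℕ) (n : ℕ) (A₀ A : ℕ → ℕ → ℕ) : Prop :=
  (∀ a ≠ 2, A a = A₀ a) ∧ ∀ F, HitsC4 H F → (dset n A).card ≤ 4 * (dset n A ∩ F).card

/-- If step `v` of a loop preserves the invariant, enlarges `D`, and makes `D` have a property `Hit v`
that passes to larger sets, then the loop makes `D` have all the properties `Hit v`. -/
theorem iter_collect {f : ℕ → (ℕ → ℕ → ℕ) → ℕ → ℕ → ℕ} {m : ℕ} (Hit : ℕ → Finset ℕ → Prop)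
    (hmono : ∀ v S S', S ⊆ S' → Hit v S → Hit v S')
    (hf : ∀ v < m, ∀ A, PackInv H n A₀ A → PackInv H n A₀ (f v A) ∧
      dset n A ⊆ dset n (f v A) ∧ Hit v (dset n (f v A)))
    (h : PackInv H n A₀ A) : PackInv H n A₀ (iter f A m) ∧ dset n A ⊆ dset n (iter f A m) ∧
      ∀ v < m, Hit v (dset n (iter f A m)) := by
  refine iter_induction (fun t B => PackInv H n A₀ B ∧ dset n A ⊆ dset n B ∧
    ∀ v < t, Hit v (dset n B)) ⟨h, subset_rfl, by simp⟩ fun t ht B hB => ?_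
  obtain ⟨h1, h2, h3⟩ := hf t ht B hB.1
  refine ⟨h1, hB.2.1.trans h2, fun v hv => ?_⟩
  rcases Nat.lt_succ_iff_lt_or_eq.1 hv with hv | rfl
  · exact hmono v _ _ h2 (hB.2.2 v hv)
  · exact h3

theorem Meets.mono {a b c d : ℕ} {S S' : Finset ℕ} (h : S ⊆ S') (hm : Meets H a b c d S) :
    Meets H a b c d S' := fun h1 h2 h3 h4 h5 h6 =>
  (hm h1 h2 h3 h4 h5 h6).imp (@h _) (Or.imp (@h _) (Or.imp (@h _) (@h _)))

theorem card_union_le_four_mul {S P F : Finset ℕ} (hdisj : Disjoint S P) (hP : P.card ≤ 4)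
    (hPF : (P ∩ F).Nonempty) (h : S.card ≤ 4 * (S ∩ F).card) :
    (S ∪ P).card ≤ 4 * ((S ∪ P) ∩ F).card := by
  rw [Finset.union_inter_distrib_right, Finset.card_union_of_disjoint hdisj,
    Finset.card_union_of_disjoint (hdisj.mono Finset.inter_subset_left Finset.inter_subset_left)]
  have := Finset.card_pos.2 hPF
  omega

theorem run_packStep (hn : ρ 0 = n)
    (hadj : ∀ u < n, ∀ v < n, (A₀ 0 (u * n + v) ≠ 0 ↔ H.Adj u v))
    (h10 : ρ 10 < n) (h11 : ρ 11 < n) (h12 : ρ 12 < n) (h13 : ρ 13 < n) (h : PackInv H n A₀ A) :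
    PackInv H n A₀ (packStep.run ρ A) ∧ dset n A ⊆ dset n (packStep.run ρ A) ∧
      Meets H (ρ 10) (ρ 11) (ρ 12) (ρ 13) (dset n (packStep.run ρ A)) := by
  have hadjE : ∀ x y, ρ x < n → ρ y < n → (T A (adjE x y) ρ ↔ H.Adj (ρ x) (ρ y)) := by
    intro x y hx hy
    rw [adjE, T_read, ← hadj _ hx _ hy, h.1 0 (by norm_num)]
    simp [hn]
  have hin : ∀ x, ρ x < n → (T A (inD x) ρ ↔ ρ x ∈ dset n A) := by
    intro x hx
    simp [inD, dset, hx]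
  have hc4 : T A c4E ρ ↔ ((ρ 10 ∉ dset n A ∧ ρ 11 ∉ dset n A) ∧ ρ 12 ∉ dset n A ∧ ρ 13 ∉ dset n A) ∧
      (ρ 10 ≠ ρ 12 ∧ ρ 11 ≠ ρ 13) ∧ (H.Adj (ρ 10) (ρ 11) ∧ H.Adj (ρ 11) (ρ 12)) ∧
        H.Adj (ρ 12) (ρ 13) ∧ H.Adj (ρ 13) (ρ 10) := by
    simp only [c4E, T_andE, T_notE, T_eqE, eval_var, hin _ h10, hin _ h11, hin _ h12, hin _ h13,
      hadjE _ _ h10 h11, hadjE _ _ h11 h12, hadjE _ _ h12 h13, hadjE _ _ h13 h10, ne_eq]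
  by_cases hT : T A c4E ρ
  · have hrun : packStep.run ρ A =
        (addD 13).run ρ ((addD 12).run ρ ((addD 11).run ρ ((addD 10).run ρ A))) := by
      simp only [packStep, St.run]
      exact if_pos hT
    have hadd : ∀ x B, ρ x < n → dset n ((addD x).run ρ B) = insert (ρ x) (dset n B) := by
      intro x B hx
      ext v
      by_cases hv : v = ρ x <;> simp [dset, addD, St.run, hv, hx]
    have hset : dset n (packStep.run ρ A) =
        insert (ρ 13) (insert (ρ 12) (insert (ρ 11) (insert (ρ 10) (dset n A)))) := by
      rw [hrun, hadd _ _ h13, hadd _ _ h12, hadd _ _ h11, hadd _ _ h10]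
    obtain ⟨⟨⟨a1, a2⟩, a3, a4⟩, ⟨b1, b2⟩, ⟨c1, c2⟩, c3, c4⟩ := hc4.1 hT
    obtain ⟨P, hP⟩ : ∃ P : Finset ℕ, P = {ρ 13, ρ 12, ρ 11, ρ 10} := ⟨_, rfl⟩
    have hset' : dset n (packStep.run ρ A) = dset n A ∪ P := by
      rw [hset, hP, Finset.union_comm, Finset.insert_union, Finset.insert_union,
        Finset.insert_union, Finset.singleton_union]
    have hdisj : Disjoint (dset n A) P := by
      rw [hP, Finset.disjoint_right]
      simp only [Finset.mem_insert, Finset.mem_singleton]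
      rintro v (rfl | rfl | rfl | rfl) <;> assumption
    rw [hset']
    have hmem : ρ 10 ∈ dset n A ∪ P := Finset.mem_union_right _ (by rw [hP]; simp)
    refine ⟨⟨fun a ha => ?_, fun F hF => ?_⟩, Finset.subset_union_left, fun _ _ _ _ _ _ =>
      Or.inl hmem⟩
    · rw [hrun, ← h.1 a ha]
      simp [addD, St.run, ha]
    · rw [hset']
      refine card_union_le_four_mul hdisj (hP ▸ Finset.card_le_four) ?_ (h.2 F hF)
      subst hP
      rcases hF _ _ _ _ b1 b2 c1 c2 c3 c4 with h | h | h | h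
      all_goals exact ⟨_, Finset.mem_inter.2 ⟨by simp, h⟩⟩
  · have hrun : packStep.run ρ A = A := by
      simp only [packStep, St.run]
      exact if_neg hT
    rw [hrun]
    refine ⟨h, subset_rfl, fun h1 h2 h3 h4 h5 h6 => ?_⟩
    by_contra hc
    simp only [not_or] at hc
    exact hT (hc4.2 ⟨⟨⟨hc.1, hc.2.1⟩, hc.2.2⟩, ⟨h1, h2⟩, ⟨h3, h4⟩, h5, h6⟩)

/-- A single pass over all quadruples suffices, since `D` only grows. -/
theorem run_packSt (hn : ρ 0 = n)
    (hadj : ∀ u < n, ∀ v < n, (A 0 (u * n + v) ≠ 0 ↔ H.Adj u v))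
    (hlt : ∀ u v, H.Adj u v → u < n) (h2 : ∀ v, A 2 v = 0) :
    PackInv H n A (packSt.run ρ A) ∧ HitsC4 H (dset n (packSt.run ρ A)) := by
  have h0 : PackInv H n A A := ⟨fun _ _ => rfl, fun F _ => by simp [dset, h2]⟩
  have key : PackInv H n A (packSt.run ρ A) ∧ dset n A ⊆ dset n (packSt.run ρ A) ∧
      ∀ a < n, ∀ b < n, ∀ c < n, ∀ d < n, Meets H a b c d (dset n (packSt.run ρ A)) := by
    simp only [packSt, St.run, hn]
    refine iter_collect (fun a S => ∀ b < n, ∀ c < n, ∀ d < n, Meets H a b c d S)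
      (fun a S S' hS h b hb c hc d hd => (h b hb c hc d hd).mono hS)
      (fun a ha B hB => ?_) h0
    simp only [Function.update_of_ne (show (0 : ℕ) ≠ 10 by norm_num), hn]
    refine iter_collect (fun b S => ∀ c < n, ∀ d < n, Meets H a b c d S)
      (fun b S S' hS h c hc d hd => (h c hc d hd).mono hS)
      (fun b hb B hB => ?_) hB
    simp only [Function.update_of_ne (show (0 : ℕ) ≠ 10 by norm_num),
      Function.update_of_ne (show (0 : ℕ) ≠ 11 by norm_num), hn]
    refine iter_collect (fun c S => ∀ d < n, Meets H a b c d S) (fun c S S' hS h d hd => (h d hd).mono hS)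
      (fun c hc B hB => ?_) hB
    simp only [Function.update_of_ne (show (0 : ℕ) ≠ 10 by norm_num),
      Function.update_of_ne (show (0 : ℕ) ≠ 11 by norm_num),
      Function.update_of_ne (show (0 : ℕ) ≠ 12 by norm_num), hn]
    refine iter_collect (fun d S => Meets H a b c d S) (fun d S S' hS h => h.mono hS) (fun d hd B hB => ?_) hB
    exact run_packStep (by simpa using hn) hadj ha hb hc hd hB
  exact ⟨key.1, fun a b c d hac hbd hab hbc hcd hda =>
    key.2.2 a (hlt _ _ hab) b (hlt _ _ hbc) c (hlt _ _ hcd) d (hlt _ _ hda) hac hbd hab hbc hcd hda⟩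

end Pack

/-! ### Powers of two -/

/-- Store `2 ^ r` in cell `v` of array `4`, where `r` is the number of elements of `D` below `v`. -/
def powSt : St := .seq (.write 4 (.const 0) (.const 1)) (.forDo 10 0 (.ite (inD 10)
  (.write 4 (.add (.var 10) (.const 1)) (.add (.read 4 (.var 10)) (.read 4 (.var 10))))
  (.write 4 (.add (.var 10) (.const 1)) (.read 4 (.var 10)))))

/-- Double cell `0` of array `a`. -/
def dblSt (a : ℕ) : St :=
  .write a (.const 0) (.add (.read a (.const 0)) (.read a (.const 0)))

/-- Multiply cell `0` of array `a` by `2 ^ (|D| + k + 2)`. -/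
def scaleSt (a : ℕ) : St := .seq (.forDo 10 0 (.ite (inD 10) (dblSt a) .skip))
  (.seq (.forDo 10 3 (dblSt a)) (.seq (dblSt a) (dblSt a)))

/-- Compute the bound on the number of candidates, and its `k`-th power. -/
def boundSt : St := .seq (.write 6 (.const 0) (.const 1)) (.seq (scaleSt 6)
  (.seq (.write 7 (.const 0) (.const 1)) (.forDo 11 3 (scaleSt 7))))

section Pow
variable {n k : ℕ} {D : Finset ℕ} {ρ : ℕ → ℕ} {A : ℕ → ℕ → ℕ}

theorem run_powSt (hn : ρ 0 = n) (hD : ∀ v < n, (A 2 v ≠ 0 ↔ v ∈ D)) :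
    (∀ v ≤ n, powSt.run ρ A 4 v = 2 ^ Nat.count (· ∈ D) v) ∧ ∀ a ≠ 4, powSt.run ρ A a = A a := by
  simp only [powSt, St.run, hn]
  refine iter_induction (fun t (B : ℕ → ℕ → ℕ) => (∀ v ≤ t, B 4 v = 2 ^ Nat.count (· ∈ D) v) ∧
    ∀ a ≠ 4, B a = A a) ⟨by simp, fun a ha => by simp [ha]⟩ fun t ht B hB => ?_
  have h1 := hB.1 t le_rfl
  have h2 : (inD 10).eval B (Function.update ρ 10 t) ≠ 0 ↔ t ∈ D := by
    rw [← hD t ht]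
    simp [inD, hB.2 2 (by norm_num)]
  have h3 : ∀ v, v ≤ t + 1 → v = t + 1 ∨ v ≠ t + 1 ∧ v ≤ t := fun v hv => by omega
  by_cases htD : t ∈ D
  · rw [if_pos (h2.2 htD)]
    refine ⟨fun v hv => ?_, fun a ha => by simp [ha, hB.2 a ha]⟩
    rcases h3 v hv with rfl | ⟨hne, hv⟩
    · simp [h1, Nat.count_succ, htD, pow_succ, mul_two]
    · simp [hne, hB.1 v hv]
  · rw [if_neg (fun h => htD (h2.1 h))]
    refine ⟨fun v hv => ?_, fun a ha => by simp [ha, hB.2 a ha]⟩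
    rcases h3 v hv with rfl | ⟨hne, hv⟩
    · simp [h1, Nat.count_succ, htD]
    · simp [hne, hB.1 v hv]

theorem run_dblSt (a : ℕ) : (dblSt a).run ρ A a 0 = A a 0 * 2 ∧
    ∀ b ≠ a, (dblSt a).run ρ A b = A b :=
  ⟨by simp [dblSt, St.run, mul_two], fun b hb => by simp [dblSt, St.run, hb]⟩

theorem run_scaleSt (hn : ρ 0 = n) (hk : ρ 3 = k) (hDn : D ⊆ Finset.range n)
    (hD : ∀ v < n, (A 2 v ≠ 0 ↔ v ∈ D)) {a : ℕ} (ha : a ≠ 2) :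
    (scaleSt a).run ρ A a 0 = A a 0 * 2 ^ (D.card + k + 2) ∧
      ∀ b ≠ a, (scaleSt a).run ρ A b = A b := by
  have hcount : Nat.count (· ∈ D) n = D.card := by
    rw [Nat.count_eq_card_filter_range, Finset.filter_mem_eq_inter,
      Finset.inter_eq_right.2 hDn]
  have h1 := iter_induction (f := fun v => (St.ite (inD 10) (dblSt a) .skip).run
      (Function.update ρ 10 v)) (a := A) (m := n)
    (fun t B => B a 0 = A a 0 * 2 ^ Nat.count (· ∈ D) t ∧ ∀ b ≠ a, B b = A b) (by simp)
    (fun t ht B hB => by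
      have h2 : (inD 10).eval B (Function.update ρ 10 t) ≠ 0 ↔ t ∈ D := by
        rw [← hD t ht]
        simp [inD, hB.2 2 ha.symm]
      obtain ⟨h3, h4⟩ := run_dblSt (ρ := Function.update ρ 10 t) (A := B) a
      by_cases htD : t ∈ D
      · rw [St.run, if_pos (h2.2 htD)]
        refine ⟨?_, fun b hb => (h4 b hb).trans (hB.2 b hb)⟩
        rw [h3, hB.1, Nat.count_succ, if_pos htD, pow_succ, mul_assoc]
      · rw [St.run, if_neg (fun h => htD (h2.1 h))]
        refine ⟨?_, hB.2⟩
        simp [St.run, hB.1, Nat.count_succ, htD])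
  rw [hcount] at h1
  set B₁ := iter (fun v => (St.ite (inD 10) (dblSt a) .skip).run (Function.update ρ 10 v)) A n
    with hB₁
  have h2 := iter_induction (f := fun v => (dblSt a).run (Function.update ρ 10 v)) (a := B₁) (m := k)
    (fun t B => B a 0 = A a 0 * 2 ^ (D.card + t) ∧ ∀ b ≠ a, B b = A b) h1
    (fun t ht B hB => by
      obtain ⟨h3, h4⟩ := run_dblSt (ρ := Function.update ρ 10 t) (A := B) a
      refine ⟨?_, fun b hb => (h4 b hb).trans (hB.2 b hb)⟩
      rw [h3, hB.1, ← add_assoc, pow_succ, mul_assoc])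
  set B₂ := iter (fun v => (dblSt a).run (Function.update ρ 10 v)) B₁ k with hB₂
  have hrun : (scaleSt a).run ρ A = (dblSt a).run ρ ((dblSt a).run ρ B₂) := by
    simp only [scaleSt, St.run, hn, hk, hB₂, hB₁]
  obtain ⟨h3, h4⟩ := run_dblSt (ρ := ρ) (A := B₂) a
  obtain ⟨h5, h6⟩ := run_dblSt (ρ := ρ) (A := (dblSt a).run ρ B₂) a
  rw [hrun]
  refine ⟨?_, fun b hb => (h6 b hb).trans ((h4 b hb).trans (h2.2 b hb))⟩
  rw [h5, h3, h2.1]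
  ring

theorem run_boundSt (hn : ρ 0 = n) (hk : ρ 3 = k) (hDn : D ⊆ Finset.range n)
    (hD : ∀ v < n, (A 2 v ≠ 0 ↔ v ∈ D)) :
    boundSt.run ρ A 6 0 = 2 ^ (D.card + k + 2) ∧
      boundSt.run ρ A 7 0 = (2 ^ (D.card + k + 2)) ^ k ∧
      ∀ b, b ∉ [6, 7] → boundSt.run ρ A b = A b := by
  set A₁ := (St.write 6 (.const 0) (.const 1)).run ρ A with hA₁
  have h1 : ∀ b ≠ 6, A₁ b = A b := fun b hb => by simp [hA₁, St.run, hb]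
  obtain ⟨h2, h3⟩ := run_scaleSt (A := A₁) hn hk hDn
    (fun v hv => by rw [h1 2 (by norm_num)]; exact hD v hv) (a := 6) (by norm_num)
  have h0 : A₁ 6 0 = 1 := by simp [hA₁, St.run]
  rw [h0, one_mul] at h2
  set A₂ := (scaleSt 6).run ρ A₁
  set A₃ := (St.write 7 (.const 0) (.const 1)).run ρ A₂ with hA₃
  have h4 : ∀ b ≠ 7, A₃ b = A₂ b := fun b hb => by simp [hA₃, St.run, hb]
  have h5 : A₃ 7 0 = 1 := by simp [hA₃, St.run]
  have h6 : boundSt.run ρ A = iter (fun v => (scaleSt 7).run (Function.update ρ 11 v)) A₃ k := by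
    rw [← hk]
    rfl
  rw [h6]
  have h7 := iter_induction (f := fun v => (scaleSt 7).run (Function.update ρ 11 v)) (a := A₃)
    (m := k) (fun t B => B 7 0 = (2 ^ (D.card + k + 2)) ^ t ∧ ∀ b ≠ 7, B b = A₃ b) (by simp [h5])
    (fun t ht B hB => by
      obtain ⟨h8, h9⟩ := run_scaleSt (ρ := Function.update ρ 11 t) (A := B) (by simpa using hn)
        (by simpa using hk) hDn (fun v hv => by
          rw [hB.2 2 (by norm_num), h4 2 (by norm_num), h3 2 (by norm_num), h1 2 (by norm_num)]
          exact hD v hv) (a := 7) (by norm_num)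
      refine ⟨?_, fun b hb => (h9 b hb).trans (hB.2 b hb)⟩
      rw [h8, hB.1]
      exact (pow_succ _ _).symm)
  refine ⟨?_, h7.1, fun b hb => ?_⟩
  · rw [h7.2 6 (by norm_num), h4 6 (by norm_num), h2]
  · simp only [List.mem_cons, List.not_mem_nil, or_false, not_or] at hb
    rw [h7.2 b hb.2, h4 b hb.2, h3 b hb.1, h1 b hb.1]

end Pow
end BFVD

namespace BFVD
open Ex

/-! ### The algorithm -/

/-- Compute `D`, the powers of two, and the bounds. -/
def prepSt : St := .seq packSt (.seq powSt boundSt)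

/-- The program, given compiled versions `p` and `q` of the preparation and of the search. -/
def mainProg (p q : Prog) : Prog :=
  .seq (.write 9 (.const 0) (.reg 1)) (.seq (.write 9 (.const 1) (.reg 2)) (.seq p
    (.seq (.assign 4 (.read 4 (.reg 0))) (.seq (.assign 5 (.read 6 (.const 0)))
      (.seq (.assign 6 (.read 7 (.const 0))) (.seq q (.assign 0
        (.sub (.const 1) (.sub (.const 1) (.read 8 (.const 0)))))))))))

theorem run_prepSt {n i j k : ℕ} {G : SimpleGraph (Fin n)} {ρ : ℕ → ℕ} {A : ℕ → ℕ → ℕ}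
    (hn : ρ 0 = n) (hk : ρ 3 = k) (hi : A 9 0 = i) (hj : A 9 1 = j)
    (hadj : ∀ u < n, ∀ v < n, (A 0 (u * n + v) ≠ 0 ↔ (natGraph G).Adj u v))
    (h2 : ∀ v, A 2 v = 0) (h8 : A 8 0 = 0) :
    ∃ D ⊆ Finset.range n, D.card ≤ 4 * fvn G ∧ HitsC4 (natGraph G) D ∧
      prepSt.run ρ A 4 n = 2 ^ D.card ∧ prepSt.run ρ A 6 0 = 2 ^ (D.card + k + 2) ∧
      prepSt.run ρ A 7 0 = (2 ^ (D.card + k + 2)) ^ k ∧ prepSt.run ρ A 8 0 = 0 ∧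
      ∀ ρ', ρ' 0 = n → ρ' 3 = k → ρ' 4 = 2 ^ D.card →
        Encodes (natGraph G) n i j k D ρ' (prepSt.run ρ A) := by
  have hlt : ∀ u v, (natGraph G).Adj u v → u < n := by
    intro u v h
    obtain ⟨u, v, -, rfl, rfl⟩ := natGraph_adj.1 h
    exact u.2
  obtain ⟨⟨h3, h4⟩, h5⟩ := run_packSt hn hadj hlt h2
  set A₁ := packSt.run ρ A
  set D := dset n A₁ with hD
  have hDn : D ⊆ Finset.range n := Finset.filter_subset _ _
  have hmem : ∀ v < n, (A₁ 2 v ≠ 0 ↔ v ∈ D) := fun v hv => by simp [hD, dset, hv]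
  obtain ⟨h6, h7⟩ := run_powSt hn hmem
  set A₂ := powSt.run ρ A₁
  have hmem' : ∀ v < n, (A₂ 2 v ≠ 0 ↔ v ∈ D) := by rwa [h7 2 (by norm_num)]
  obtain ⟨h9, h10, h11⟩ := run_boundSt hn hk hDn hmem'
  have hrun : prepSt.run ρ A = boundSt.run ρ A₂ := rfl
  rw [hrun]
  set A₃ := boundSt.run ρ A₂
  have hcount : Nat.count (· ∈ D) n = D.card := by
    rw [Nat.count_eq_card_filter_range, Finset.filter_mem_eq_inter, Finset.inter_eq_right.2 hDn]
  have h12 : ∀ a, a ∉ [2, 4, 6, 7] → A₃ a = A a := fun a ha => by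
    simp only [List.mem_cons, List.not_mem_nil, or_false, not_or] at ha
    rw [h11 a (by simp [ha]), h7 a ha.2.1, h3 a ha.1]
  refine ⟨D, hDn, ?_, h5, ?_, h9, h10, ?_, fun ρ' hn' hk' hw' => ?_⟩
  · obtain ⟨F, hF, hF'⟩ := exists_hitsC4 G
    rw [← hF]
    exact (h4 F hF').trans
      (Nat.mul_le_mul_left 4 (Finset.card_le_card Finset.inter_subset_right))
  · rw [h11 4 (by decide), h6 n le_rfl, hcount]
  · rw [h12 8 (by decide), h8]
  · refine ⟨hn', by rw [h12 9 (by decide), hi], by rw [h12 9 (by decide), hj], hk', hw',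
      by rwa [h12 0 (by decide)], by rwa [h11 2 (by decide)], fun v hv => ?_⟩
    rw [h11 4 (by decide)]
    exact h6 v hv.le

theorem inputState_adj {n i j k : ℕ} {G : SimpleGraph (Fin n)} {u v : ℕ} (hu : u < n) (hv : v < n) :
    (inputState G i j k).arr 0 (u * n + v) ≠ 0 ↔ (natGraph G).Adj u v := by
  have h1 : ∀ u' v' : Fin n, u * n + v = u' * n + v' → (u' : ℕ) = u ∧ (v' : ℕ) = v := by
    intro u' v' h
    have hn : 0 < n := by omega
    have h2 := congrArg (· / n) h
    have h3 := congrArg (· % n) h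
    simp only [Nat.mul_add_mod_self_right, Nat.mod_eq_of_lt hv, Nat.mod_eq_of_lt v'.2] at h3
    rw [Nat.mul_comm u, Nat.mul_comm u'] at h2
    simp only [Nat.mul_add_div hn, Nat.div_eq_of_lt hv, Nat.div_eq_of_lt v'.2, add_zero] at h2
    exact ⟨h2.symm, h3.symm⟩
  rw [natGraph_adj]
  simp only [inputState]
  constructor
  · intro h
    by_contra hc
    rw [if_neg] at h
    · exact h rfl
    rintro ⟨-, u', v', hadj, he⟩
    exact hc ⟨u', v', hadj, h1 u' v' he⟩
  · rintro ⟨u', v', hadj, rfl, rfl⟩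
    rw [if_pos ⟨rfl, u', v', hadj, rfl⟩]
    exact one_ne_zero

/-- The number of guesses, and with it the range of all loop counters, is within the bound. -/
theorem range_le {d f k n : ℕ} (hk : 1 ≤ k) (hd : d ≤ 4 * f) :
    (2 ^ (d + k + 2)) ^ k * (n + 1) + 2 ≤ 2 ^ (6 * (k ^ 2 + f * k)) * (n + 1) := by
  have hk2 : k ≤ k ^ 2 := Nat.le_self_pow (by norm_num) k
  have h1 : (d + k + 2) * k + 2 ≤ 6 * (k ^ 2 + f * k) := by
    have : d * k ≤ 4 * f * k := Nat.mul_le_mul_right k hd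
    nlinarith
  have h2 : (2 ^ (d + k + 2)) ^ k * 4 ≤ 2 ^ (6 * (k ^ 2 + f * k)) := by
    calc (2 ^ (d + k + 2)) ^ k * 4 = 2 ^ ((d + k + 2) * k + 2) := by
          rw [← pow_mul, pow_add]
          norm_num
      _ ≤ _ := Nat.pow_le_pow_right (by norm_num) h1
  have h3 : 1 ≤ (2 ^ (d + k + 2)) ^ k := Nat.one_le_pow _ _ (by positivity)
  have h4 := Nat.mul_le_mul_right (n + 1) h2
  nlinarith

/-- Both phases of the algorithm, with the input and output operations, run in time polynomial
in a bound on the variables. -/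
theorem solvesWithin_mainProg : ∃ (p : Prog) (c : ℕ), ∀ (n : ℕ) (G : SimpleGraph (Fin n))
    (i j k : ℕ), 0 < i → 0 < j → 1 ≤ k → ∃ d ≤ 4 * fvn G,
      SolvesWithin p G i j k (((2 ^ (d + k + 2)) ^ k * (n + 1) + 2) ^ c) := by
  obtain ⟨p, hp⟩ := prepSt.compile [0, 3] (by decide)
  obtain ⟨q, hq⟩ := searchSt.compile [0, 3, 4, 5, 6] (by decide)
  obtain ⟨c, hc⟩ := exists_add_le_pow (exists_add_le_pow prepSt.exists_time_le
    searchSt.exists_time_le) (g := fun _ => 12) ⟨4, fun N =>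
      le_trans (by norm_num) (Nat.pow_le_pow_left (by omega : 2 ≤ N + 2) 4)⟩
  refine ⟨mainProg p q, c, fun n G i j k hi hj hk => ?_⟩
  let s₀ := inputState G i j k
  let s₁ := (s₀.setArr 9 0 i).setArr 9 1 j
  have hreg : s₁.reg = s₀.reg := rfl
  have hn : s₁.reg 0 = n := by simp [hreg, s₀, inputState]
  have hk' : s₁.reg 3 = k := by simp [hreg, s₀, inputState]
  have harr : ∀ a, a ≠ 9 → s₁.arr a = s₀.arr a := fun a ha => by
    simp [s₁, State.setArr, ha]
  have hzero : ∀ a, a ≠ 0 → ∀ m, s₀.arr a m = 0 := fun a ha m => by simp [s₀, inputState, ha]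
  obtain ⟨D, hDn, hDc, hC4, h4, h6, h7, h8, hE⟩ := run_prepSt (G := G) (i := i) (j := j) hn hk'
    (A := s₁.arr) (by simp [s₁, State.setArr]) (by simp [s₁, State.setArr])
    (fun u hu v hv => by rw [harr 0 (by norm_num)]; exact inputState_adj hu hv)
    (fun v => by rw [harr 2 (by norm_num)]; exact hzero 2 (by norm_num) v)
    (by rw [harr 8 (by norm_num)]; exact hzero 8 (by norm_num) 0)
  refine ⟨D.card, hDc, ?_⟩
  set d := D.card
  set M := 2 ^ (d + k + 2) with hM
  set N := M ^ k * (n + 1) with hN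
  -- All variables are at most `N`.
  have hMk : M ≤ M ^ k := Nat.le_self_pow (by omega) M
  have hTN : M ^ k ≤ N := Nat.le_mul_of_pos_right _ (by omega)
  have hMN : M ≤ N := hMk.trans hTN
  have hnN : n ≤ N := (Nat.le_succ n).trans (Nat.le_mul_of_pos_left _ (by positivity))
  have hkN : k ≤ N := (Nat.lt_two_pow_self (n := k)).le.trans
    ((Nat.pow_le_pow_right (by norm_num) (by omega)).trans hMN)
  have hdN : 2 ^ d ≤ N := (Nat.pow_le_pow_right (by norm_num) (by omega)).trans hMN
  obtain ⟨t, s₂, e1, e2, e3⟩ := hp N s₁.reg s₁.arr s₁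
    (by simp [hn, hk', hnN, hkN]) ⟨fun _ _ => rfl, fun _ _ => rfl⟩
  have hn₂ : s₂.reg 0 = n := (e3.1 0 (by decide)).trans hn
  have hk₂ : s₂.reg 3 = k := (e3.1 3 (by decide)).trans hk'
  let s₃ := ((s₂.setReg 4 (2 ^ d)).setReg 5 M).setReg 6 (M ^ k)
  have r0 : s₃.reg 0 = n := by simp [s₃, State.setReg, hn₂]
  have r3 : s₃.reg 3 = k := by simp [s₃, State.setReg, hk₂]
  have r4 : s₃.reg 4 = 2 ^ d := by simp [s₃, State.setReg]
  have r5 : s₃.reg 5 = M := by simp [s₃, State.setReg]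
  have r6 : s₃.reg 6 = M ^ k := by simp [s₃, State.setReg]
  obtain ⟨t', s₄, e4, e5, e6⟩ := hq N s₃.reg (prepSt.run s₁.reg s₁.arr) s₃
    (by simp [r0, r3, r4, r5, r6, hnN, hkN, hdN, hMN, hTN]) ⟨fun _ _ => rfl, e3.2⟩
  have hsearch := run_searchSt (hE s₃.reg r0 r3 r4) hDn (by rw [r5]) h8
  rw [r6, ← isYes_iff hDn hC4 hi hj, ← e6.2 8 (by norm_num)] at hsearch
  have a1 : Exec (.write 9 (.const 0) (.reg 1)) s₀ 3 (s₀.setArr 9 0 i) := by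
    have := Exec.write 9 (.const 0) (.reg 1) s₀
    simpa [Expr.cost, Expr.eval, s₀, inputState] using this
  have a2 : Exec (.write 9 (.const 1) (.reg 2)) (s₀.setArr 9 0 i) 3 s₁ := by
    have := Exec.write 9 (.const 1) (.reg 2) (s₀.setArr 9 0 i)
    simpa [Expr.cost, Expr.eval, s₀, s₁, inputState, State.setArr] using this
  have a3 : Exec (.assign 4 (.read 4 (.reg 0))) s₂ 3 (s₂.setReg 4 (2 ^ d)) := by
    have := Exec.assign 4 (.read 4 (.reg 0)) s₂
    simpa [Expr.cost, Expr.eval, hn₂, e3.2 4 (by norm_num), h4] using this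
  have a4 : Exec (.assign 5 (.read 6 (.const 0))) (s₂.setReg 4 (2 ^ d)) 3
      ((s₂.setReg 4 (2 ^ d)).setReg 5 M) := by
    have := Exec.assign 5 (.read 6 (.const 0)) (s₂.setReg 4 (2 ^ d))
    simpa only [Expr.cost, Expr.eval, State.setReg, e3.2 6 (by norm_num), h6] using this
  have a5 : Exec (.assign 6 (.read 7 (.const 0))) ((s₂.setReg 4 (2 ^ d)).setReg 5 M) 3 s₃ := by
    have := Exec.assign 6 (.read 7 (.const 0)) ((s₂.setReg 4 (2 ^ d)).setReg 5 M)
    simpa only [Expr.cost, Expr.eval, State.setReg, s₃, e3.2 7 (by norm_num), h7] using this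
  have a6 := Exec.assign 0 (.sub (.const 1) (.sub (.const 1) (.read 8 (.const 0)))) s₄
  refine ⟨_, _, .seq a1 (.seq a2 (.seq e1 (.seq a3 (.seq a4 (.seq a5 (.seq e4 a6)))))), ?_,
    fun h => ?_, fun h => ?_⟩
  · refine le_trans ?_ (hc N)
    simp only [Expr.cost]
    omega
  · have := hsearch.2 h
    simp only [State.setReg, Expr.eval, Function.update_self]
    omega
  · have : s₄.arr 8 0 = 0 := by
      by_contra hne
      exact h (hsearch.1 hne)
    simp [State.setReg, Expr.eval, this]

end BFVD

theorem mainTheorem2 :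
    ∃ (p : BFVD.Prog) (c : ℕ), ∀ (n : ℕ) (G : SimpleGraph (Fin n)) (i j k : ℕ),
      2 ≤ i → i ≤ j → 1 ≤ k →
        BFVD.SolvesWithin p G i j k (2 ^ (c * (k ^ 2 + BFVD.fvn G * k)) * (n + 1) ^ c) := by
  obtain ⟨p, c, h⟩ := BFVD.solvesWithin_mainProg
  refine ⟨p, 6 * c, fun n G i j k hi hij hk => ?_⟩
  obtain ⟨d, hd, t, s, h1, h2, h3⟩ := h n G i j k (by omega) (by omega) hk
  refine ⟨t, s, h1, h2.trans ?_, h3⟩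
  calc ((2 ^ (d + k + 2)) ^ k * (n + 1) + 2) ^ c
      ≤ (2 ^ (6 * (k ^ 2 + BFVD.fvn G * k)) * (n + 1)) ^ c :=
        Nat.pow_le_pow_left (BFVD.range_le hk hd) c
    _ = 2 ^ (6 * c * (k ^ 2 + BFVD.fvn G * k)) * (n + 1) ^ c := by
        rw [mul_pow, ← pow_mul]
        congr 2
        ring
    _ ≤ _ := Nat.mul_le_mul_left _ (Nat.pow_le_pow_right (by omega) (by omega))
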